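/- Let $\mathcal N,\mathcal M$ be quantum channels (completely positive trace-preserving maps) from operators on a finite-dimensional space $A\neq 0$ to operators on a finite-dimensional space $B$. For states put $D(\sigma\|\rho)=\mathrm{tr}[\sigma(\log\sigma-\log\rho)]$ if $\mathrm{supp}\,\sigma\subseteq\mathrm{supp}\,\rho$ and $D(\sigma\|\rho)=\infty$ otherwise (natural logarithms), and let $D_M(\sigma\|\rho)$ be the supremum, over all finite-outcome POVMs, of the classical relative entropy $D(q\|p)$ of the outcome distributions $q$ of $\sigma$ and $p$ of $\rho$. For channels put $$D(\mathcal M^{\otimes l}\|\mathcal N^{\otimes l})=\sup_\rho D\big(\mathcal M^{\otimes l}(\rho)\,\|\,\mathcal N^{\otimes l}(\rho)\big),\qquad D_M(\mathcal M^{\otimes l}\|\mathcal N^{\otimes l})=\sup_\rho D_M\big(\mathcal M^{\otimes l}(\rho)\,\|\,\mathcal N^{\otimes l}(\rho)\big),$$ where $\rho$ ranges over all states of $A^{\otimes l}\otimes R$ with a reference system $R$ of arbitrary finite dimension, on which the channels act trivially. **Change point problem.** At step $n=1,2,\dots$ one use of a channel is available, which is $\mathcal N$ if $n\le\nu$ and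 $\mathcal M$ if $n>\nu$; here $\nu\in\{0,1,2,\dots\}\cup\{\infty\}$, and $\nu=\infty$ means that there is no change. **Block QUSUM.** Fix a block length $l\ge1$, a state $\rho$ of $A^{\otimes l}\otimes R$, a POVM $E$ on $B^{\otimes l}\otimes R$ and a threshold $h$. In every block of $l$ consecutive channel uses a fresh copy of $\rho$ is fed into the $l$ uses and $E$ is measured on the $l$ outputs and $R$, with outcome $X_k$ in block $k$. Let $p(x)=\mathrm{tr}[E_x\mathcal N^{\otimes l}(\rho)]$, $q(x)=\mathrm{tr}[E_x\mathcal M^{\otimes l}(\rho)]$ and $Z_k=\log\frac{q(X_k)}{p(X_k)}\in[-\infty,\infty]$. The alarm time, counted in channel uses, is $T=l\,T^\star$, where $$T^\star=\min_{j\ge1}T_j,\qquad T_j=\min\Big\{n\ge j:\ \sum_{i=j}^n Z_i\ge h\Big\}\qquad(\min\emptyset=\infty).$$ A block that contains the change point is processed in the same way, its uses being partly of $\mathcal N$ and partly of $\mathcal M$. With $P_\nu,\mathbb E_\nu$ the probability and expectation for change point $\nu$, let $$\bar T_{\rm FA}=\mathbb E_\infty[T],\qquad \bar\tau^\star=\sup_{0\le\nu<\infty}\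 \sup_{x^\nu:\,P_\infty(X^\nu=x^\nu)>0}\mathbb E_\nu[\,T-\nu\mid T>\nu,\ X^\nu=x^\nu\,],$$ where $X^\nu$ is the record of the outcomes of the $\lfloor\nu/l\rfloor$ blocks completed by time $\nu$, and records for which the alarm has been raised by time $\nu$ are left out. **Theorem.** 1. The limits of $\frac1l D(\mathcal M^{\otimes l}\|\mathcal N^{\otimes l})$ and of $\frac1l D_M(\mathcal M^{\otimes l}\|\mathcal N^{\otimes l})$ as $l\to\infty$ exist in $[0,\infty]$ and are equal. Their common value is the regularized channel relative entropy $D^\infty(\mathcal M\|\mathcal N)$. 2. Suppose $D^\infty(\mathcal M\|\mathcal N)<\infty$ (if $D^\infty(\mathcal M\|\mathcal N)=0$, the upper bounds on $\bar\tau^\star$ below are read as $\infty$). For every $\varepsilon>0$ there are $l,\rho,E$ such that for all sufficiently large $t$ the block QUSUM with $(l,\rho,E)$ and threshold $h=\log t$ satisfies $$\bar T_{\rm FA}\ge t\qquad\text{and}\qquad \bar\tau^\star\le\frac{(1+\varepsilon)\log t}{D^\infty(\mathcal M\|\mathcal N)}.$$ Moreover, there is a function $\delta$ with $\delta(t)\to0$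 as $t\to\infty$ such that for all sufficiently large $t$ some block QUSUM, with $(l,\rho,E)$ depending on $t$ and threshold $h=\log t$, satisfies $$\bar T_{\rm FA}\ge t\qquad\text{and}\qquad \bar\tau^\star\le\frac{(1+\delta(t))\log t}{D^\infty(\mathcal M\|\mathcal N)}.$$ In particular, $\bar\tau^\star\le\log\bar T_{\rm FA}\,(1+o(1))/D^\infty(\mathcal M\|\mathcal N)$ as $\bar T_{\rm FA}\to\infty$. -/

import Mathlib

open MeasureTheory Filter Topology
open scoped ENNReal Matrix ComplexOrder

noncomputable section

namespace ChangePoint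

/-! ### States, channels, measurements (finite dimension) -/

/-- A density operator on `ℂ^α`. -/
def IsState {α : Type*} [Fintype α] (ρ : Matrix α α ℂ) : Prop :=
  ρ.PosSemidef ∧ ρ.trace = 1

/-- The map `Φ ⊗ id` on operators of the system `α` together with a reference system `κ`:
`Φ` acts on each of the blocks of `X` that are labelled by a pair of reference indices. -/
def ampliate {α β : Type*} (κ : Type*)
    (Φ : Matrix α α ℂ →ₗ[ℂ] Matrix β β ℂ) (X : Matrix (α × κ) (α × κ) ℂ) :
    Matrix (β × κ) (β × κ) ℂ :=
  Matrix.of fun i j => Φ (Matrix.of fun x x' => X (x, i.2) (x', j.2)) i.1 j.1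

/-- A quantum channel: a completely positive and trace preserving linear map. -/
structure IsChannel {α β : Type*} [Fintype α] [Fintype β]
    (Φ : Matrix α α ℂ →ₗ[ℂ] Matrix β β ℂ) : Prop where
  completelyPositive : ∀ (r : ℕ) (X : Matrix (α × Fin r) (α × Fin r) ℂ),
    X.PosSemidef → (ampliate (Fin r) Φ X).PosSemidef
  tracePreserving : ∀ X : Matrix α α ℂ, (Φ X).trace = X.trace

/-- The tensor product `Φ 0 ⊗ ⋯ ⊗ Φ (l - 1)`, as a map between operators on `(ℂ^α)^{⊗ l}` and
operators on `(ℂ^β)^{⊗ l}`; it is given by its values on the matrix units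
`|x⟩⟨x'| = ⨂ s, |x s⟩⟨x' s|`, extended linearly. -/
def tensorChannel {α β : Type*} [Fintype α] [DecidableEq α] {l : ℕ}
    (Φ : Fin l → (Matrix α α ℂ →ₗ[ℂ] Matrix β β ℂ)) :
    Matrix (Fin l → α) (Fin l → α) ℂ →ₗ[ℂ] Matrix (Fin l → β) (Fin l → β) ℂ where
  toFun X := Matrix.of fun y y' =>
    ∑ x, ∑ x', X x x' * ∏ s, Φ s (Matrix.single (x s) (x' s) 1) (y s) (y' s)
  map_add' X Y := by
    ext y y'
    simp [add_mul, Finset.sum_add_distrib]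
  map_smul' c X := by
    ext y y'
    simp [Finset.mul_sum, mul_assoc]

/-- The tensor power `Φ^{⊗ l}`. -/
def tensorPower {α β : Type*} [Fintype α] [DecidableEq α]
    (Φ : Matrix α α ℂ →ₗ[ℂ] Matrix β β ℂ) (l : ℕ) :
    Matrix (Fin l → α) (Fin l → α) ℂ →ₗ[ℂ] Matrix (Fin l → β) (Fin l → β) ℂ :=
  tensorChannel fun _ => Φ

/-- A positive operator valued measure on `ℂ^α` with outcomes in `Fin m`. -/
structure POVM (α : Type*) [Fintype α] [DecidableEq α] (m : ℕ) where
  effect : Fin m → Matrix α α ℂ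
  posSemidef : ∀ x, (effect x).PosSemidef
  sum_eq_one : ∑ x, effect x = 1

/-- The Born rule: the probability `tr[E_x ω]` of the outcome `x` in the state `ω`. -/
def bornProb {α : Type*} [Fintype α] [DecidableEq α] {m : ℕ}
    (E : POVM α m) (ω : Matrix α α ℂ) (x : Fin m) : ℝ≥0∞ :=
  ENNReal.ofReal ((E.effect x * ω).trace.re)

/-- The law of the outcome of the measurement `E` of the state `ω`. -/
def bornLaw {α : Type*} [Fintype α] [DecidableEq α] {m : ℕ}
    (E : POVM α m) (ω : Matrix α α ℂ) : Measure (Fin m) :=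
  ∑ x, bornProb E ω x • Measure.dirac x

/-! ### Relative entropies -/

open Classical in
/-- The relative entropy `D(σ‖ρ) = tr[σ (log σ - log ρ)]` of two states (natural logarithm, with
the value `0` at `0`), and `D(σ‖ρ) = ∞` unless the support of `σ` is contained in that of `ρ`,
that is, unless the kernel of `ρ` is contained in that of `σ`. -/
def relEntropy {α : Type*} [Fintype α] [DecidableEq α] (σ ρ : Matrix α α ℂ) : ℝ≥0∞ :=
  if ∀ v : α → ℂ, ρ *ᵥ v = 0 → σ *ᵥ v = 0 then
    ENNReal.ofReal ((σ * (cfc Real.log σ - cfc Real.log ρ)).trace.re)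
  else ∞

/-- The measured relative entropy `D_M(σ‖ρ)`: the supremum over all measurements of the classical
relative entropy of the two laws of the outcome. -/
def measuredRelEntropy {α : Type*} [Fintype α] [DecidableEq α] (σ ρ : Matrix α α ℂ) : ℝ≥0∞ :=
  ⨆ (m : ℕ) (E : POVM α m), InformationTheory.klDiv (bornLaw E σ) (bornLaw E ρ)

/-- The channel relative entropy `D(Ψ‖Φ)`: the supremum of `D(Ψ(ρ)‖Φ(ρ))` over all input states,
possibly entangled with a reference system of arbitrarily large dimension. -/
def channelRelEntropy {α β : Type*} [Fintype α] [Fintype β] [DecidableEq β]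
    (Ψ Φ : Matrix α α ℂ →ₗ[ℂ] Matrix β β ℂ) : ℝ≥0∞ :=
  ⨆ (r : ℕ) (ρ : Matrix (α × Fin r) (α × Fin r) ℂ) (_ : IsState ρ),
    relEntropy (ampliate (Fin r) Ψ ρ) (ampliate (Fin r) Φ ρ)

/-- The measured channel relative entropy `D_M(Ψ‖Φ)`: the supremum of `D_M(Ψ(ρ)‖Φ(ρ))` over all
input states, possibly entangled with a reference system of arbitrarily large dimension. -/
def measuredChannelRelEntropy {α β : Type*} [Fintype α] [Fintype β] [DecidableEq β]
    (Ψ Φ : Matrix α α ℂ →ₗ[ℂ] Matrix β β ℂ) : ℝ≥0∞ :=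
  ⨆ (r : ℕ) (ρ : Matrix (α × Fin r) (α × Fin r) ℂ) (_ : IsState ρ),
    measuredRelEntropy (ampliate (Fin r) Ψ ρ) (ampliate (Fin r) Φ ρ)

/-- The regularized channel relative entropy `D^∞(M‖N) = lim_l (1/l) D(M^{⊗ l}‖N^{⊗ l})`.
It is written as an upper limit, so that it makes sense before the limit is known to exist. -/
def regularizedRelEntropy {α β : Type*} [Fintype α] [DecidableEq α] [Fintype β] [DecidableEq β]
    (M N : Matrix α α ℂ →ₗ[ℂ] Matrix β β ℂ) : ℝ≥0∞ :=
  limsup (fun l : ℕ => channelRelEntropy (tensorPower M l) (tensorPower N l) / (l : ℝ≥0∞)) atTop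

/-! ### QUSUM on blocks of channel uses -/

/-- A way of processing a block of `l` channel uses: an input state `ρ` of the `l` channel inputs
and a reference system, and a collective measurement `E` of the `l` outputs and the reference. -/
structure BlockScheme (α β : Type*) [Fintype α] [Fintype β] [DecidableEq β] where
  l : ℕ
  l_pos : 0 < l
  r : ℕ
  m : ℕ
  ρ : Matrix ((Fin l → α) × Fin r) ((Fin l → α) × Fin r) ℂ
  isState : IsState ρ
  E : POVM ((Fin l → β) × Fin r) m

namespace BlockScheme

variable {α β : Type*} [Fintype α] [DecidableEq α] [Fintype β] [DecidableEq β]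
  (S : BlockScheme α β) (N M : Matrix α α ℂ →ₗ[ℂ] Matrix β β ℂ)

/-- The output state of a block whose `l` uses are uses of the channels `Φ 0, …, Φ (l - 1)`. -/
def output (Φ : Fin S.l → (Matrix α α ℂ →ₗ[ℂ] Matrix β β ℂ)) :
    Matrix ((Fin S.l → β) × Fin S.r) ((Fin S.l → β) × Fin S.r) ℂ :=
  ampliate (Fin S.r) (tensorChannel Φ) S.ρ

/-- The sequence of channels with change point `ν` (`ν = ⊤` means that there is no change). The
uses are numbered `t = 0, 1, 2, …`: the first `ν` uses are uses of `N`, all later ones of `M`. -/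
def channelAt (ν : ℕ∞) (t : ℕ) : Matrix α α ℂ →ₗ[ℂ] Matrix β β ℂ :=
  if (t : ℕ∞) < ν then N else M

/-- `P_ν`: the law of the sequence of the outcomes of the blocks when the change point is `ν`.
Block `k` consists of the uses `k l, …, k l + l - 1` and may straddle the change point. Every block
has a fresh input state and its own measurement, so the outcomes are independent. -/
def law (ν : ℕ∞) : Measure (ℕ → Fin S.m) :=
  Measure.infinitePi fun k : ℕ =>
    bornLaw S.E (S.output fun s => channelAt N M ν (k * S.l + s))

/-- The log-likelihood ratio `Z = log (q(x) / p(x))` of an outcome `x`, where `q(x)` and `p(x)` are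
its probabilities for `l` uses of `M` and of `N`; it is `-∞` if `q(x) = 0`. -/
def logLikelihood (x : Fin S.m) : EReal :=
  ENNReal.log (bornProb S.E (S.output fun _ => M) x / bornProb S.E (S.output fun _ => N) x)

/-- The first `n > j` for which the log-likelihood ratios of the blocks `j, …, n - 1` sum up to at
least `h`, that is, the number of blocks used when the test for a change before block `j` stops. -/
def stopFrom (h : ℝ) (j : ℕ) (ω : ℕ → Fin S.m) : ℕ∞ :=
  ⨅ (n : ℕ) (_ : j < n ∧ (h : EReal) ≤ ∑ i ∈ Finset.Ico j n, S.logLikelihood N M (ω i)), (n : ℕ∞)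

/-- The alarm time of QUSUM with threshold `h`, counted in channel uses: `l` times the CUSUM
stopping time of the sequence of block outcomes. -/
def alarmTime (h : ℝ) (ω : ℕ → Fin S.m) : ℕ∞ :=
  (S.l : ℕ∞) * ⨅ j : ℕ, S.stopFrom N M h j ω

/-- The mean false alarm time `E_∞[T]`. -/
def meanFalseAlarmTime (h : ℝ) : ℝ≥0∞ :=
  ∫⁻ ω, (S.alarmTime N M h ω : ℝ≥0∞) ∂(S.law N M ⊤)

/-- The event that the outcomes obtained during the first `ν` channel uses, which are those of the
first `⌊ν / l⌋` blocks, agree with `x`. -/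
def past (ν : ℕ) (x : ℕ → Fin S.m) : Set (ℕ → Fin S.m) :=
  {ω | ∀ k < ν / S.l, ω k = x k}

/-- The worst-worst case mean delay: the supremum of `E_ν[T - ν | T > ν, X^ν = x^ν]` over all
change points `ν` and all records `x^ν` with `P_∞(X^ν = x^ν) > 0`. Records with which the alarm
has been raised by the time `ν` contribute nothing. -/
def worstMeanDelay (h : ℝ) : ℝ≥0∞ :=
  ⨆ (ν : ℕ) (x : ℕ → Fin S.m) (_ : 0 < S.law N M ⊤ (S.past ν x)),
    ∫⁻ ω, ((S.alarmTime N M h ω : ℝ≥0∞) - (ν : ℝ≥0∞))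
      ∂(ProbabilityTheory.cond (S.law N M ν)
        ({ω | (ν : ℕ∞) < S.alarmTime N M h ω} ∩ S.past ν x))

end BlockScheme

end ChangePoint

end

namespace ChangePoint

/-! ### Classical relative entropy on finite sets -/

/-! The proof has a quantum half, which identifies the rate, and a classical half, which analyses
CUSUM for independent block outcomes.

Quantum half. Let `g l` be the measured channel relative entropy of `l` uses. Product inputs and
product measurements show that `g` is superadditive (`measuredChannelRelEntropy_add_le`), so by
Fekete's lemma `g l / l` tends to `⨆ g n / n`. It remains to squeeze the unmeasured rate. It is at
least the measured one by data processing for measurements (`klFin_le_relEntropy`). Here the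
relative entropy of two states is the classical relative entropy of the pair of weights `|⟨u i, v
j⟩|² a i` and `|⟨u i, v j⟩|² b j` built from their eigenvalues and eigenvectors. Classical relative
entropies can be compared through the quantities `∑ q² / (p + s q)`, and for these a measurement
loses by completing a square (`resolvent_le`). Conversely, take `k` copies of an output pair `σ, ρ`.
The operator `ρ^{⊗ k}` has only polynomially many eigenvalues, one per type. Pinching `σ^{⊗ k}` to
its eigenspaces gives an operator that commutes with `ρ^{⊗ k}`, at an entropy cost at most
logarithmic in `k` (`exists_pinching_measurement`). Measuring in a common eigenbasis therefore gives
`k D(σ‖ρ) - O(log k) ≤ g (k l)`, and the relative entropy of an output pair of `l` uses is at most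
`l ⨆ g n / n` (`Reachable.relEntropy_le`). The predicate `Reachable` is stable under isometries and
tensor products, and every measurement of a reachable pair is a measurement of genuine channel
outputs.

Classical half. Without a change, the Shiryaev–Roberts statistic `R n` dominates every likelihood
product monitored by CUSUM, and `R n - n` has nonpositive drift because the likelihood ratio has
mean at most `1`. Stopping when `R ≥ t` thus takes mean time at least `t`
(`le_tsum_of_shiryaevRoberts`). After a change, QUSUM stops no later than the single test started at
the first block that certainly follows the change. Its increments have mean `D`, the relative
entropy of the block outcomes, and a Wald-type argument bounds its mean length by `(h + C) / D`
blocks, where `C` bounds the overshoot (`worstMeanDelay_le`). The past is independent of these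
blocks, so conditioning on the record does not matter. A block scheme with `D / l` close to the
regularized relative entropy, and `h = log t` large compared with `l` and `C`, gives the bound for
fixed `ε`. A diagonal argument gives `δ(t) → 0`. -/

open Classical in
/-- The relative entropy of two families of nonnegative weights on a finite set. -/
noncomputable def klFin {ι : Type*} [Fintype ι] (q p : ι → ℝ) : ℝ≥0∞ :=
  if ∀ x, p x = 0 → q x = 0 then ENNReal.ofReal (∑ x, q x * Real.log (q x / p x)) else ∞

/-- The measure on a finite set with given nonnegative weights. -/
noncomputable def finLaw {m : ℕ} (q : Fin m → ℝ) : Measure (Fin m) :=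
  ∑ x, ENNReal.ofReal (q x) • Measure.dirac x

lemma finLaw_singleton {m : ℕ} (q : Fin m → ℝ) (x : Fin m) :
    finLaw q {x} = ENNReal.ofReal (q x) := by
  simp [finLaw, Measure.finsetSum_apply, Set.indicator_apply, Finset.sum_ite_eq']

lemma isProbabilityMeasure_finLaw {m : ℕ} {q : Fin m → ℝ} (h0 : ∀ x, 0 ≤ q x)
    (h1 : ∑ x, q x = 1) : IsProbabilityMeasure (finLaw q) := by
  constructor
  simp [finLaw, Measure.finsetSum_apply, ← ENNReal.ofReal_sum_of_nonneg (fun x _ => h0 x), h1]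

lemma klDiv_finLaw {m : ℕ} {q p : Fin m → ℝ} (hq0 : ∀ x, 0 ≤ q x) (hq1 : ∑ x, q x = 1)
    (hp0 : ∀ x, 0 ≤ p x) (hp1 : ∑ x, p x = 1) :
    InformationTheory.klDiv (finLaw q) (finLaw p) = klFin q p := by
  have := isProbabilityMeasure_finLaw hq0 hq1
  have := isProbabilityMeasure_finLaw hp0 hp1
  unfold klFin
  split_ifs with h
  -- At points with `p x = 0` the quotient has the default value `0`, which is harmless because `q x
  -- = 0` there.
  · have hd : finLaw q = (finLaw p).withDensity fun x => ENNReal.ofReal (q x / p x) := by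
      refine Measure.ext_of_singleton fun x => ?_
      rw [withDensity_apply _ (measurableSet_singleton x), lintegral_singleton, finLaw_singleton,
        finLaw_singleton]
      rcases (hp0 x).eq_or_lt with hx | hx
      · simp [← hx, h x hx.symm]
      · rw [← ENNReal.ofReal_mul (div_nonneg (hq0 x) hx.le), div_mul_cancel₀ _ hx.ne']
    have hac : finLaw q ≪ finLaw p := hd ▸ withDensity_absolutelyContinuous _ _
    rw [InformationTheory.klDiv_of_ac_of_integrable hac .of_finite, integral_fintype .of_finite]
    simp only [probReal_univ, add_sub_cancel_right]
    congr 1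
    refine Finset.sum_congr rfl fun x _ => ?_
    rw [Measure.real, finLaw_singleton, ENNReal.toReal_ofReal (hq0 x), smul_eq_mul]
    rcases (hq0 x).eq_or_lt with hx | hx
    · simp [← hx]
    have hpx : 0 < p x := (hp0 x).lt_of_ne fun h' => hx.ne' (h x h'.symm)
    have hr : (finLaw q).rnDeriv (finLaw p) x = ENNReal.ofReal (q x / p x) := by
      have := Measure.rnDeriv_withDensity (finLaw p)
        (f := fun x => ENNReal.ofReal (q x / p x)) (by fun_prop)
      rw [← hd] at this
      -- The derivative is known only almost everywhere, but an exceptional point would be a null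
      -- set, whereas `x` has mass `p x > 0`.
      by_contra hne
      have h0 := measure_mono_null (s := {x}) (Set.singleton_subset_iff.2 hne) this
      simp only [finLaw_singleton, ENNReal.ofReal_eq_zero] at h0
      linarith
    rw [llr, hr, ENNReal.toReal_ofReal (div_nonneg (hq0 x) (hp0 x))]
  · apply InformationTheory.klDiv_of_not_ac
    intro hac
    refine h fun x hx => ?_
    have := hac (s := {x}) (by rw [finLaw_singleton, hx, ENNReal.ofReal_zero])
    rw [finLaw_singleton, ENNReal.ofReal_eq_zero] at this
    exact le_antisymm this (hq0 x)

lemma hasDerivAt_sum_mul_log {ι : Type*} [Fintype ι] {q p : ι → ℝ} (hq : ∀ x, 0 ≤ q x)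
    (hp : ∀ x, 0 ≤ p x) {s : ℝ} (hs : 0 < s) :
    HasDerivAt (fun s => ∑ x, q x * Real.log (p x + s * q x))
      (∑ x, q x ^ 2 / (p x + s * q x)) s := by
  refine HasDerivAt.fun_sum fun x _ => ?_
  rcases (hq x).eq_or_lt with hx | hx
  · simpa [← hx] using hasDerivAt_const s (0 : ℝ)
  · have hpos : p x + s * q x ≠ 0 := by have := hp x; positivity
    have h1 : HasDerivAt (fun s => p x + s * q x) (q x) s := by
      simpa using ((hasDerivAt_id s).mul_const (q x)).const_add (p x)
    exact (h1.log hpos).const_mul (q x) |>.congr_deriv (by rw [← mul_div_assoc, sq])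

lemma continuousOn_sum_mul_log {ι : Type*} [Fintype ι] {q p : ι → ℝ} (hq : ∀ x, 0 ≤ q x)
    (hp : ∀ x, 0 ≤ p x) (hpq : ∀ x, p x = 0 → q x = 0) :
    ContinuousOn (fun s => ∑ x, q x * Real.log (p x + s * q x)) (Set.Ici 0) := by
  refine continuousOn_finsetSum _ fun x _ => ?_
  rcases (hp x).eq_or_lt with hx | hx
  · simpa [hpq x hx.symm] using continuousOn_const
  · refine continuousOn_const.mul (ContinuousOn.log (by fun_prop) fun s hs => ?_)
    have := mul_nonneg (Set.mem_Ici.1 hs) (hq x)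
    positivity

lemma tendsto_sum_mul_log_sub {ι : Type*} [Fintype ι] {q p : ι → ℝ} (hq : ∀ x, 0 ≤ q x)
    (hp : ∀ x, 0 ≤ p x) :
    Tendsto (fun s : ℝ => ∑ x, q x * Real.log (p x + s * q x) - (∑ x, q x) * Real.log s) atTop
      (𝓝 (∑ x, q x * Real.log (q x))) := by
  simp_rw [Finset.sum_mul, ← Finset.sum_sub_distrib, ← mul_sub]
  refine tendsto_finsetSum _ fun x _ => ?_
  rcases (hq x).eq_or_lt with hx | hx
  · simp [← hx]
  · refine Tendsto.const_mul _ ?_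
    have h1 : Tendsto (fun s : ℝ => p x / s + q x) atTop (𝓝 (q x)) := by
      simpa using (tendsto_const_nhds.div_atTop tendsto_id).add_const (q x)
    refine (h1.log hx.ne').congr' ?_
    filter_upwards [eventually_gt_atTop 0] with s hs
    have hpos : p x + s * q x ≠ 0 := by have := hp x; positivity
    rw [← Real.log_div hpos hs.ne']
    congr 1
    field_simp

lemma sum_mul_log_div {ι : Type*} [Fintype ι] {q p : ι → ℝ} (hpq : ∀ x, p x = 0 → q x = 0) :
    ∑ x, q x * Real.log (q x / p x) =
      ∑ x, q x * Real.log (q x) - ∑ x, q x * Real.log (p x) := by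
  rw [← Finset.sum_sub_distrib]
  refine Finset.sum_congr rfl fun x _ => ?_
  by_cases hx : q x = 0
  · simp [hx]
  · rw [Real.log_div hx fun h' => hx (hpq x h'), mul_sub]

/-- Relative entropy is the integral of `∑ q² / (p + s q)` over `s`, up to a constant that does not
depend on the distributions; hence it is monotone with respect to these quantities. -/
lemma kl_le_of_resolvent_le {ι κ : Type*} [Fintype ι] [Fintype κ] {q p : ι → ℝ} {Q P : κ → ℝ}
    (hq0 : ∀ x, 0 ≤ q x) (hp0 : ∀ x, 0 ≤ p x) (hQ0 : ∀ x, 0 ≤ Q x) (hP0 : ∀ x, 0 ≤ P x)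
    (hsum : ∑ x, q x = ∑ y, Q y) (hac : ∀ y, P y = 0 → Q y = 0)
    (h : ∀ s : ℝ, 0 < s → ∑ x, q x ^ 2 / (p x + s * q x) ≤ ∑ y, Q y ^ 2 / (P y + s * Q y)) :
    (∀ x, p x = 0 → q x = 0) ∧
      ∑ x, q x * Real.log (q x / p x) ≤ ∑ y, Q y * Real.log (Q y / P y) := by
  have hpq : ∀ x, p x = 0 → q x = 0 := by
    intro x hx
    by_contra hne
    have hqx : 0 < q x := (hq0 x).lt_of_ne' hne
    set C := ∑ y, Q y ^ 2 / P y with hC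
    have hC0 : 0 ≤ C := Finset.sum_nonneg fun y _ => div_nonneg (sq_nonneg _) (hP0 y)
    have key : ∀ s : ℝ, 0 < s → q x / s ≤ C := by
      intro s hs
      have h1 : q x ^ 2 / (p x + s * q x) ≤ ∑ x, q x ^ 2 / (p x + s * q x) :=
        Finset.single_le_sum (f := fun x => q x ^ 2 / (p x + s * q x))
          (fun y _ => div_nonneg (sq_nonneg _) (add_nonneg (hp0 y) (mul_nonneg hs.le (hq0 y))))
          (Finset.mem_univ x)
      have h2 : ∑ y, Q y ^ 2 / (P y + s * Q y) ≤ C := by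
        refine Finset.sum_le_sum fun y _ => ?_
        rcases (hP0 y).eq_or_lt with hy | hy
        · simp [hac y hy.symm]
        · exact div_le_div_of_nonneg_left (sq_nonneg _) hy
            (le_add_of_nonneg_right (mul_nonneg hs.le (hQ0 y)))
      have h3 : q x ^ 2 / (p x + s * q x) = q x / s := by
        rw [hx, zero_add]; field_simp
      linarith [h s hs]
    -- If `p x = 0 < q x`, the left side blows up like `q x / s` as `s → 0`, while the right side
    -- stays below `C`. This `s` makes `q x / s = C + 1`.
    have := key (q x / (C + 1)) (by positivity)
    rw [div_div_cancel₀ hne] at this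
    linarith
  refine ⟨hpq, ?_⟩
  -- With `F s = ∑ q log (p + s q)`, the hypothesis compares the derivatives. At `s = 0` the value
  -- is `∑ q log p`, and `F s - (∑ q) log s` tends to `∑ q log q`. The logarithmic terms of the two
  -- families cancel because the total masses agree.
  have hanti : AntitoneOn (fun s => ∑ x, q x * Real.log (p x + s * q x) -
      ∑ y, Q y * Real.log (P y + s * Q y)) (Set.Ici 0) := by
    refine antitoneOn_of_deriv_nonpos (convex_Ici 0)
      ((continuousOn_sum_mul_log hq0 hp0 hpq).sub (continuousOn_sum_mul_log hQ0 hP0 hac)) ?_ ?_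
    · intro s hs
      rw [interior_Ici] at hs
      exact ((hasDerivAt_sum_mul_log hq0 hp0 hs).sub
        (hasDerivAt_sum_mul_log hQ0 hP0 hs)).differentiableAt.differentiableWithinAt
    · intro s hs
      rw [interior_Ici] at hs
      have := ((hasDerivAt_sum_mul_log hq0 hp0 hs).sub (hasDerivAt_sum_mul_log hQ0 hP0 hs)).deriv
      simp only [Pi.sub_def] at this
      rw [this]
      linarith [h s hs]
  have hle : ∑ x, q x * Real.log (q x) - ∑ y, Q y * Real.log (Q y) ≤
      ∑ x, q x * Real.log (p x) - ∑ y, Q y * Real.log (P y) := by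
    refine le_of_tendsto ((tendsto_sum_mul_log_sub hq0 hp0).sub (tendsto_sum_mul_log_sub hQ0 hP0)) ?_
    filter_upwards [eventually_ge_atTop 0] with s hs
    have := hanti (Set.mem_Ici.2 le_rfl) (Set.mem_Ici.2 hs) hs
    simp only [zero_mul, add_zero] at this
    rw [hsum]
    linarith
  rw [sum_mul_log_div hpq, sum_mul_log_div hac]
  linarith

end ChangePoint

namespace ChangePoint

open Matrix

/-! ### Spectral decompositions and the relative entropy -/

lemma exists_spectral_decomposition {γ : Type*} [Fintype γ] [DecidableEq γ] {σ : Matrix γ γ ℂ}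
    (h : σ.PosSemidef) : ∃ (U : Matrix γ γ ℂ) (a : γ → ℝ), Uᴴ * U = 1 ∧ U * Uᴴ = 1 ∧
      (∀ i, 0 ≤ a i) ∧ σ = U * diagonal (fun i => (a i : ℂ)) * Uᴴ ∧
      ∀ f : ℝ → ℝ, cfc f σ = U * diagonal (fun i => (f (a i) : ℂ)) * Uᴴ := by
  have hσ := h.isHermitian
  refine ⟨hσ.eigenvectorUnitary, hσ.eigenvalues, ?_, ?_, h.eigenvalues_nonneg, ?_, fun f => ?_⟩
  · exact Unitary.coe_star_mul_self _
  · exact Unitary.coe_mul_star_self _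
  · conv_lhs => rw [hσ.spectral_theorem, Unitary.conjStarAlgAut_apply]
    rfl
  · rw [hσ.cfc_eq, IsHermitian.cfc, Unitary.conjStarAlgAut_apply]
    rfl

lemma trace_mul_conj_diagonal {γ δ : Type*} [Fintype γ] [Fintype δ] [DecidableEq δ]
    (X : Matrix γ γ ℂ) (U : Matrix γ δ ℂ) (c : δ → ℂ) :
    (X * (U * diagonal c * Uᴴ)).trace = ∑ i, c i * (Uᴴ * X * U) i i := by
  rw [← Matrix.mul_assoc, trace_mul_comm, ← Matrix.mul_assoc, ← Matrix.mul_assoc, trace]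
  simp [mul_diagonal, mul_comm]

lemma conj_diagonal_apply_self {γ δ : Type*} [Fintype γ] [Fintype δ] [DecidableEq δ]
    (W : Matrix γ δ ℂ) (c : δ → ℝ) (i : γ) :
    (W * diagonal (fun j => (c j : ℂ)) * Wᴴ) i i = ((∑ j, Complex.normSq (W i j) * c j : ℝ) : ℂ) := by
  rw [mul_apply]
  push_cast
  refine Finset.sum_congr rfl fun j _ => ?_
  rw [mul_diagonal, conjTranspose_apply, Complex.normSq_eq_conj_mul_self, Complex.star_def]
  ring

lemma sum_normSq_of_mul_conjTranspose {γ δ : Type*} [Fintype δ] [DecidableEq γ] [Fintype γ]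
    [DecidableEq δ] {W : Matrix γ δ ℂ} (hW : W * Wᴴ = 1) (i : γ) :
    ∑ j, Complex.normSq (W i j) = 1 := by
  have := conj_diagonal_apply_self W (fun _ => 1) i
  simp only [Complex.ofReal_one, diagonal_one, mul_one, Matrix.mul_one, hW, one_apply_eq] at this
  exact_mod_cast this.symm

lemma trace_mul_nonneg {γ : Type*} [Fintype γ] [DecidableEq γ] {A B : Matrix γ γ ℂ}
    (hA : A.PosSemidef) (hB : B.PosSemidef) : 0 ≤ (A * B).trace.re := by
  obtain ⟨U, b, -, -, hb, rfl, -⟩ := exists_spectral_decomposition hB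
  rw [trace_mul_conj_diagonal, Complex.re_sum]
  refine Finset.sum_nonneg fun i _ => ?_
  rw [Complex.re_ofReal_mul]
  exact mul_nonneg (hb i) (Complex.nonneg_iff.1 (hA.conjTranspose_mul_mul_same U).diag_nonneg).1

lemma trace_diag_conj {γ δ : Type*} [Fintype γ] [Fintype δ] [DecidableEq γ] [DecidableEq δ]
    {U : Matrix γ δ ℂ} (hU : Uᴴ * U = 1) (c : δ → ℂ) :
    (U * diagonal c * Uᴴ).trace = ∑ i, c i := by
  have := trace_mul_conj_diagonal 1 U c
  rw [Matrix.one_mul, Matrix.mul_one, hU] at this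
  simpa using this

/-- The relative entropy in terms of two spectral decompositions. -/
lemma trace_mul_log_sub_log {γ : Type*} [Fintype γ] [DecidableEq γ] {U V : Matrix γ γ ℂ}
    {a la lb : γ → ℝ} (hU : Uᴴ * U = 1) (hV' : V * Vᴴ = 1) :
    ((U * diagonal (fun i => (a i : ℂ)) * Uᴴ) * ((U * diagonal (fun i => (la i : ℂ)) * Uᴴ) -
        (V * diagonal (fun i => (lb i : ℂ)) * Vᴴ))).trace.re =
      ∑ i, ∑ j, Complex.normSq ((Uᴴ * V) i j) * a i * (la i - lb j) := by
  have hW : (Uᴴ * V) * (Uᴴ * V)ᴴ = 1 := by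
    rw [conjTranspose_mul, conjTranspose_conjTranspose, mul_assoc, ← mul_assoc V, hV', one_mul, hU]
  rw [trace_mul_comm, trace_mul_conj_diagonal, Complex.re_sum]
  refine Finset.sum_congr rfl fun i _ => ?_
  have h1 : Uᴴ * (U * diagonal (fun i => (la i : ℂ)) * Uᴴ) * U = diagonal (fun i => (la i : ℂ)) := by
    simp only [mul_assoc, hU, mul_one]
    rw [← mul_assoc, hU, one_mul]
  have h2 : Uᴴ * (V * diagonal (fun i => (lb i : ℂ)) * Vᴴ) * U =
      (Uᴴ * V) * diagonal (fun i => (lb i : ℂ)) * (Uᴴ * V)ᴴ := by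
    simp only [mul_assoc, conjTranspose_mul, conjTranspose_conjTranspose]
  rw [Matrix.mul_sub, Matrix.sub_mul, h1, h2, Matrix.sub_apply, conj_diagonal_apply_self, diagonal_apply_eq,
    ← Complex.ofReal_sub, ← Complex.ofReal_mul, Complex.ofReal_re]
  have := sum_normSq_of_mul_conjTranspose hW i
  rw [mul_sub, Finset.mul_sum]
  conv_lhs => rw [← one_mul (a i * la i), ← this, Finset.sum_mul, ← Finset.sum_sub_distrib]
  refine Finset.sum_congr rfl fun j _ => ?_
  ring

/-! ### Measurements do not increase the relative entropy -/

/-- With `X = ∑ t x E x`, the difference `∑ t x² E x - X²` equals `∑ (t x - X) E x (t x - X)`, which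
is positive. This is the operator Jensen inequality for the square. -/
lemma trace_sq_le {γ : Type*} [Fintype γ] [DecidableEq γ] {ι : Type*} [Fintype ι]
    {E : ι → Matrix γ γ ℂ} (hE : ∀ x, (E x).PosSemidef) (hE1 : ∑ x, E x = 1) (t : ι → ℝ)
    {ρ : Matrix γ γ ℂ} (hρ : ρ.PosSemidef) :
    ((∑ x, (t x : ℂ) • E x) * (∑ x, (t x : ℂ) • E x) * ρ).trace.re ≤
      ∑ x, t x ^ 2 * (E x * ρ).trace.re := by
  set X := ∑ x, (t x : ℂ) • E x with hX
  have hXh : Xᴴ = X := by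
    simp [hX, conjTranspose_sum, conjTranspose_smul, fun x => (hE x).isHermitian.eq]
  have hexp : ∑ x, ((t x : ℂ) • (1 : Matrix γ γ ℂ) - X) * E x * ((t x : ℂ) • (1 : Matrix γ γ ℂ) - X)ᴴ =
      ∑ x, ((t x ^ 2 : ℝ) : ℂ) • E x - X * X := by
    have : ∀ x, ((t x : ℂ) • (1 : Matrix γ γ ℂ) - X) * E x *
        ((t x : ℂ) • (1 : Matrix γ γ ℂ) - X)ᴴ =
        ((t x ^ 2 : ℝ) : ℂ) • E x - ((t x : ℂ) • E x) * X - X * ((t x : ℂ) • E x) + X * E x * X := by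
      intro x
      rw [conjTranspose_sub, hXh, conjTranspose_smul, conjTranspose_one]
      simp only [Matrix.sub_mul, Matrix.mul_sub, smul_mul_assoc, one_mul, mul_smul_comm, mul_one,
        Complex.star_def, Complex.conj_ofReal, smul_smul, sq, smul_sub, Complex.ofReal_mul]
      abel
    simp only [this, Finset.sum_add_distrib, Finset.sum_sub_distrib, ← Finset.sum_mul,
      ← Finset.mul_sum, ← hX, hE1, mul_one]
    abel
  have hpos : 0 ≤ ((∑ x, ((t x ^ 2 : ℝ) : ℂ) • E x - X * X) * ρ).trace.re := by
    rw [← hexp]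
    exact trace_mul_nonneg (posSemidef_sum _ fun x _ => (hE x).mul_mul_conjTranspose_same _) hρ
  rw [Matrix.sub_mul, trace_sub, Finset.sum_mul, trace_sum, Complex.sub_re, Complex.re_sum] at hpos
  simp only [smul_mul_assoc, trace_smul, smul_eq_mul, Complex.re_ofReal_mul] at hpos
  linarith

/-- The function `q² / d` is the maximum of `2 t q - t² d` over `t`. With the optimal `t x` for each
outcome and `X = ∑ t x E x`, `trace_sq_le` bounds the left side by `2 tr Xσ - tr X²ρ - s tr X²σ`. In
the two eigenbases this decouples into one quadratic function of each matrix entry of `X`.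
Maximizing each entry separately gives the right side. -/
lemma resolvent_le {γ : Type*} [Fintype γ] [DecidableEq γ] {ι : Type*} [Fintype ι]
    {U V : Matrix γ γ ℂ} {a b : γ → ℝ} (hU' : U * Uᴴ = 1) (hV' : V * Vᴴ = 1)
    (ha : ∀ i, 0 ≤ a i) (hb : ∀ i, 0 ≤ b i)
    {E : ι → Matrix γ γ ℂ} (hE : ∀ x, (E x).PosSemidef) (hE1 : ∑ x, E x = 1)
    {σ ρ : Matrix γ γ ℂ} (hσ : σ = U * diagonal (fun i => (a i : ℂ)) * Uᴴ) (hσp : σ.PosSemidef)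
    (hρ : ρ = V * diagonal (fun i => (b i : ℂ)) * Vᴴ) (hρp : ρ.PosSemidef) {s : ℝ} (hs : 0 < s) :
    ∑ x, (E x * σ).trace.re ^ 2 / ((E x * ρ).trace.re + s * (E x * σ).trace.re) ≤
      ∑ i, ∑ j, Complex.normSq ((Uᴴ * V) i j) * (a i ^ 2 / (b j + s * a i)) := by
  set q := fun x => (E x * σ).trace.re with hq
  set p := fun x => (E x * ρ).trace.re with hp
  have hq0 : ∀ x, 0 ≤ q x := fun x => trace_mul_nonneg (hE x) hσp
  have hp0 : ∀ x, 0 ≤ p x := fun x => trace_mul_nonneg (hE x) hρp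
  set t := fun x => q x / (p x + s * q x) with ht
  set X := ∑ x, (t x : ℂ) • E x with hX
  have hXh : Xᴴ = X := by
    simp [hX, conjTranspose_sum, conjTranspose_smul, fun x => (hE x).isHermitian.eq]
  set Y := Uᴴ * X * V with hY
  have hYh : Yᴴ = Vᴴ * X * U := by
    simp [hY, conjTranspose_mul, hXh, mul_assoc]
  have h1 : (X * σ).trace.re = ∑ i, ∑ j, a i * (Y i j * star ((Uᴴ * V) i j)).re := by
    rw [hσ, trace_mul_conj_diagonal, Complex.re_sum]
    refine Finset.sum_congr rfl fun i _ => ?_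
    have : Uᴴ * X * U = Y * (Uᴴ * V)ᴴ := by
      rw [hY, conjTranspose_mul, conjTranspose_conjTranspose]
      simp only [mul_assoc]
      rw [← mul_assoc V, hV', one_mul]
    rw [Complex.re_ofReal_mul, this, mul_apply, Complex.re_sum, Finset.mul_sum]
    rfl
  have h2 : (X * X * ρ).trace.re = ∑ i, ∑ j, b j * Complex.normSq (Y i j) := by
    rw [hρ, trace_mul_conj_diagonal, Complex.re_sum, Finset.sum_comm]
    refine Finset.sum_congr rfl fun j _ => ?_
    have : Vᴴ * (X * X) * V = Yᴴ * diagonal (fun _ => ((1 : ℝ) : ℂ)) * Yᴴᴴ := by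
      rw [conjTranspose_conjTranspose, hYh, hY]
      simp only [Complex.ofReal_one, diagonal_one, mul_one, mul_assoc]
      rw [← mul_assoc U, hU', one_mul]
    rw [Complex.re_ofReal_mul, this, conj_diagonal_apply_self, Complex.ofReal_re, Finset.mul_sum]
    simp [conjTranspose_apply, Complex.normSq_conj]
  have h3 : (X * X * σ).trace.re = ∑ i, ∑ j, a i * Complex.normSq (Y i j) := by
    rw [hσ, trace_mul_conj_diagonal, Complex.re_sum]
    refine Finset.sum_congr rfl fun i _ => ?_
    have : Uᴴ * (X * X) * U = Y * diagonal (fun _ => ((1 : ℝ) : ℂ)) * Yᴴ := by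
      rw [hYh, hY]
      simp only [Complex.ofReal_one, diagonal_one, mul_one, mul_assoc]
      rw [← mul_assoc V, hV', one_mul]
    rw [Complex.re_ofReal_mul, this, conj_diagonal_apply_self, Complex.ofReal_re, Finset.mul_sum]
    simp
  have h4 : (X * σ).trace.re = ∑ x, t x * q x := by
    rw [hX, Finset.sum_mul, trace_sum, Complex.re_sum]
    simp [hq, trace_smul]
  have h5 : ∑ x, q x ^ 2 / (p x + s * q x) =
      2 * ∑ x, t x * q x - ∑ x, t x ^ 2 * p x - s * ∑ x, t x ^ 2 * q x := by
    rw [Finset.mul_sum, Finset.mul_sum, ← Finset.sum_sub_distrib, ← Finset.sum_sub_distrib]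
    refine Finset.sum_congr rfl fun x _ => ?_
    simp only [ht]
    -- A vanishing denominator makes `t x` and the quotient zero by default, so both sides vanish.
    by_cases h0 : p x + s * q x = 0
    · simp [h0]
    · obtain ⟨d, hd⟩ : ∃ d, d = p x + s * q x := ⟨_, rfl⟩
      rw [← hd] at h0 ⊢
      rw [show p x = d - s * q x by linarith]
      field_simp
      ring
  have h6 := trace_sq_le hE hE1 t hσp
  have h7 := trace_sq_le hE hE1 t hρp
  rw [← hX] at h6 h7
  calc ∑ x, q x ^ 2 / (p x + s * q x)
      ≤ 2 * (X * σ).trace.re - (X * X * ρ).trace.re - s * (X * X * σ).trace.re := by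
        rw [h5, h4]
        have := mul_le_mul_of_nonneg_left h6 hs.le
        linarith
    _ = ∑ i, ∑ j, (2 * (a i * (Y i j * star ((Uᴴ * V) i j)).re) - b j * Complex.normSq (Y i j) -
          s * (a i * Complex.normSq (Y i j))) := by
        rw [h1, h2, h3]
        simp only [Finset.sum_sub_distrib, Finset.mul_sum]
    _ ≤ _ := by
        refine Finset.sum_le_sum fun i _ => Finset.sum_le_sum fun j _ => ?_
        generalize Y i j = y
        generalize (Uᴴ * V) i j = w
        have hre : (y * star w).re = y.re * w.re + y.im * w.im := by simp [Complex.mul_re]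
        rw [hre, Complex.normSq_apply, Complex.normSq_apply]
        have hd : 0 ≤ b j + s * a i := add_nonneg (hb j) (mul_nonneg hs.le (ha i))
        rcases hd.eq_or_lt with hd | hd
        · have hai : a i = 0 := by
            have := mul_nonneg hs.le (ha i)
            have h0 : s * a i = 0 := by linarith [hb j]
            exact (mul_eq_zero.1 h0).resolve_left hs.ne'
          have hbj : b j = 0 := by rw [hai] at hd; linarith
          simp [hai, hbj]
        · rw [← mul_div_assoc, le_div_iff₀ hd]
          -- Completing the square: `|d y - a w|² ≥ 0` with `d = b + s a`, in real and imaginary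
          -- parts.
          nlinarith [sq_nonneg ((b j + s * a i) * y.re - a i * w.re),
            sq_nonneg ((b j + s * a i) * y.im - a i * w.im)]

/-- If the kernel of the second operator is contained in that of the first, its null vectors only
overlap with null vectors of the first. -/
lemma eigenvalue_mul_overlap_eq_zero {γ : Type*} [Fintype γ] [DecidableEq γ]
    {U V : Matrix γ γ ℂ} {a b : γ → ℝ} (hU : Uᴴ * U = 1) (hV : Vᴴ * V = 1)
    (h : ∀ v : γ → ℂ, (V * diagonal (fun i => (b i : ℂ)) * Vᴴ) *ᵥ v = 0 →
      (U * diagonal (fun i => (a i : ℂ)) * Uᴴ) *ᵥ v = 0) {i j : γ} (hj : b j = 0) :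
    Complex.normSq ((Uᴴ * V) i j) * a i = 0 := by
  have h1 : (V * diagonal (fun i => (b i : ℂ)) * Vᴴ) *ᵥ (V *ᵥ Pi.single j 1) = 0 := by
    rw [mulVec_mulVec, mul_assoc, hV, mul_one, ← mulVec_mulVec]
    simp [hj]
  have h2 := congrArg (fun v => (Uᴴ *ᵥ v) i) (h _ h1)
  simp only [mulVec_mulVec, mulVec_zero, Pi.zero_apply, mulVec_single_one] at h2
  rw [mul_assoc U, ← mul_assoc Uᴴ, hU, one_mul, ← mulVec_mulVec, mulVec_diagonal,
    show (Uᴴ *ᵥ V.col j) i = (Uᴴ * V) i j from rfl] at h2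
  rcases mul_eq_zero.1 h2 with h3 | h3
  · rw [Complex.ofReal_eq_zero.1 h3, mul_zero]
  · rw [h3, map_zero, zero_mul]

/-- Measurements do not increase the relative entropy. -/
lemma klFin_le_relEntropy {γ : Type*} [Fintype γ] [DecidableEq γ] {ι : Type*} [Fintype ι]
    {E : ι → Matrix γ γ ℂ} (hE : ∀ x, (E x).PosSemidef) (hE1 : ∑ x, E x = 1)
    {σ ρ : Matrix γ γ ℂ} (hσ : IsState σ) (hρ : ρ.PosSemidef) :
    klFin (fun x => (E x * σ).trace.re) (fun x => (E x * ρ).trace.re) ≤ relEntropy σ ρ := by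
  unfold relEntropy
  split_ifs with hsupp
  swap
  · exact le_top
  obtain ⟨U, a, hU, hU', ha, hσe, hσl⟩ := exists_spectral_decomposition hσ.1
  obtain ⟨V, b, hV, hV', hb, hρe, hρl⟩ := exists_spectral_decomposition hρ
  have hov : ∀ i j, b j = 0 → Complex.normSq ((Uᴴ * V) i j) * a i = 0 := by
    intro i j hj
    rw [hσe, hρe] at hsupp
    exact eigenvalue_mul_overlap_eq_zero hU hV hsupp hj
  have hW : (Uᴴ * V) * (Uᴴ * V)ᴴ = 1 := by
    rw [conjTranspose_mul, conjTranspose_conjTranspose, mul_assoc, ← mul_assoc V, hV', one_mul, hU]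
  have hsum : ∑ x, (E x * σ).trace.re = 1 := by
    rw [← Complex.re_sum, ← trace_sum, ← Finset.sum_mul, hE1, one_mul, hσ.2, Complex.one_re]
  have hsuma : ∑ i, a i = 1 := by
    have := hσ.2
    rw [hσe, trace_diag_conj hU] at this
    exact_mod_cast this
  -- `Q` and `P` are the Nussbaum–Szkoła weights on pairs of eigenvectors. Their classical relative
  -- entropy is the quantum one, and their quantities `∑ Q² / (P + s Q)` are the right side of
  -- `resolvent_le`.
  obtain ⟨hac, hle⟩ := kl_le_of_resolvent_le (q := fun x => (E x * σ).trace.re)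
    (p := fun x => (E x * ρ).trace.re)
    (Q := fun y : γ × γ => Complex.normSq ((Uᴴ * V) y.1 y.2) * a y.1)
    (P := fun y : γ × γ => Complex.normSq ((Uᴴ * V) y.1 y.2) * b y.2)
    (fun x => trace_mul_nonneg (hE x) hσ.1) (fun x => trace_mul_nonneg (hE x) hρ)
    (fun y => mul_nonneg (Complex.normSq_nonneg _) (ha _))
    (fun y => mul_nonneg (Complex.normSq_nonneg _) (hb _))
    (by
      rw [hsum, Fintype.sum_prod_type]
      simp only [← Finset.sum_mul, sum_normSq_of_mul_conjTranspose hW, one_mul, hsuma])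
    (by
      rintro ⟨i, j⟩ hy
      rcases mul_eq_zero.1 hy with h | h
      · exact mul_eq_zero.2 (Or.inl h)
      · exact hov i j h)
    (by
      intro s hs
      refine (resolvent_le hU' hV' ha hb hE hE1 hσe hσ.1 hρe hρ hs).trans_eq ?_
      rw [Fintype.sum_prod_type]
      refine Finset.sum_congr rfl fun i _ => Finset.sum_congr rfl fun j _ => ?_
      by_cases hw : Complex.normSq ((Uᴴ * V) i j) = 0
      · simp [hw]
      · simp only
        rw [show Complex.normSq ((Uᴴ * V) i j) * b j + s * (Complex.normSq ((Uᴴ * V) i j) * a i) =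
          Complex.normSq ((Uᴴ * V) i j) * (b j + s * a i) by ring, mul_pow,
          sq (Complex.normSq ((Uᴴ * V) i j)), mul_assoc, mul_div_mul_left _ _ hw, mul_div_assoc])
  unfold klFin
  rw [if_pos hac]
  refine ENNReal.ofReal_le_ofReal (hle.trans_eq ?_)
  rw [hσl, hρl]
  conv_rhs => rw [hσe]
  rw [trace_mul_log_sub_log (la := fun i => Real.log (a i)) (lb := fun i => Real.log (b i))
    hU hV', Fintype.sum_prod_type]
  refine Finset.sum_congr rfl fun i _ => Finset.sum_congr rfl fun j _ => ?_
  simp only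
  by_cases h0 : Complex.normSq ((Uᴴ * V) i j) * a i = 0
  · simp [h0]
  · have hw : Complex.normSq ((Uᴴ * V) i j) ≠ 0 := left_ne_zero_of_mul h0
    rw [mul_div_mul_left _ _ hw, Real.log_div (right_ne_zero_of_mul h0) fun hj => h0 (hov i j hj)]

end ChangePoint

namespace ChangePoint

open Matrix

/-! ### Outputs of channels are states -/

/-- A completely positive map has a Kraus representation. -/
lemma IsChannel.exists_kraus {α β : Type*} [Fintype α] [DecidableEq α] [Fintype β] [DecidableEq β]
    {Φ : Matrix α α ℂ →ₗ[ℂ] Matrix β β ℂ} (h : IsChannel Φ) :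
    ∃ K : β × Fin (Fintype.card α) → Matrix β α ℂ, ∀ x x' y y',
      Φ (single x x' 1) y y' = ∑ k, K k y x * star (K k y' x') := by
  set e := Fintype.equivFin α
  -- This is the unnormalized maximally entangled vector. The image of its projector is the Choi
  -- matrix, whose blocks are the images of matrix units, and its eigenvectors scaled by the roots
  -- of the eigenvalues are the Kraus operators.
  set v : α × Fin (Fintype.card α) → ℂ := fun z => if e z.1 = z.2 then 1 else 0 with hv
  obtain ⟨U, a, -, -, ha, hJ, -⟩ := exists_spectral_decomposition
    (h.completelyPositive _ _ (posSemidef_vecMulVec_self_star v))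
  refine ⟨fun k => Matrix.of fun y x => (Real.sqrt (a k) : ℂ) * U (y, e x) k, fun x x' y y' => ?_⟩
  have h1 := congrFun (congrFun hJ (y, e x)) (y', e x')
  have h2 : (Matrix.of fun z z' => vecMulVec v (star v) (z, e x) (z', e x')) =
      single x x' (1 : ℂ) := by
    ext z z'
    simp only [of_apply, vecMulVec_apply, hv, EmbeddingLike.apply_eq_iff_eq, Pi.star_apply,
      single_apply, @eq_comm _ z x, @eq_comm _ z' x']
    by_cases hz : x = z <;> by_cases hz' : x' = z' <;> simp [hz, hz']
  simp only [ampliate, of_apply, h2] at h1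
  rw [h1, mul_apply]
  refine Finset.sum_congr rfl fun k _ => ?_
  have h3 : (a k : ℂ) = (Real.sqrt (a k) : ℂ) * (Real.sqrt (a k) : ℂ) := by
    rw [← Complex.ofReal_mul, Real.mul_self_sqrt (ha k)]
  simp only [mul_diagonal, conjTranspose_apply, of_apply, star_mul', Complex.star_def,
    Complex.conj_ofReal]
  rw [h3]
  ring

lemma tensorChannel_apply {α β : Type*} [Fintype α] [DecidableEq α] {l : ℕ}
    (Φ : Fin l → (Matrix α α ℂ →ₗ[ℂ] Matrix β β ℂ)) (X : Matrix (Fin l → α) (Fin l → α) ℂ)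
    (y y' : Fin l → β) : tensorChannel Φ X y y' =
      ∑ x, ∑ x', X x x' * ∏ s, Φ s (single (x s) (x' s) 1) (y s) (y' s) := rfl

/-- Complete positivity is assumed for one factor at a time, so positivity of the tensor product
goes through products of Kraus operators. The factors may differ because a block can straddle the
change point. -/
lemma isState_ampliate_tensorChannel {α β : Type*} [Fintype α] [DecidableEq α] [Fintype β]
    [DecidableEq β] {κ : Type*} [Fintype κ] [DecidableEq κ] {l : ℕ}
    {Φ : Fin l → (Matrix α α ℂ →ₗ[ℂ] Matrix β β ℂ)} (hΦ : ∀ s, IsChannel (Φ s))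
    {ω : Matrix ((Fin l → α) × κ) ((Fin l → α) × κ) ℂ} (hω : IsState ω) :
    IsState (ampliate κ (tensorChannel Φ) ω) := by
  constructor
  · choose K hK using fun s => (hΦ s).exists_kraus
    have : ampliate κ (tensorChannel Φ) ω =
        ∑ k : Fin l → β × Fin (Fintype.card α),
          (Matrix.of fun (y : (Fin l → β) × κ) (x : (Fin l → α) × κ) =>
            if y.2 = x.2 then ∏ s, K s (k s) (y.1 s) (x.1 s) else 0) * ω *
          (Matrix.of fun (y : (Fin l → β) × κ) (x : (Fin l → α) × κ) =>
            if y.2 = x.2 then ∏ s, K s (k s) (y.1 s) (x.1 s) else 0)ᴴ := by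
      ext ⟨y, i⟩ ⟨y', j⟩
      simp only [ampliate, of_apply, tensorChannel_apply, Matrix.sum_apply, hK,
        Finset.prod_univ_sum, Fintype.piFinset_univ, Finset.prod_mul_distrib, Finset.mul_sum]
      rw [Finset.sum_congr rfl fun x _ => Finset.sum_comm, Finset.sum_comm]
      refine Finset.sum_congr rfl fun k _ => ?_
      simp only [mul_apply, conjTranspose_apply, of_apply, Fintype.sum_prod_type, ite_mul, zero_mul,
        Finset.sum_ite_eq, Finset.mem_univ, if_true, Finset.sum_mul, apply_ite star, star_zero,
        mul_ite, mul_zero, star_prod]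
      rw [Finset.sum_comm]
      refine Finset.sum_congr rfl fun x' _ => Finset.sum_congr rfl fun x _ => ?_
      ring
    rw [this]
    exact posSemidef_sum _ fun k _ => hω.1.mul_mul_conjTranspose_same _
  · rw [← hω.2, trace, trace]
    simp only [diag_apply, ampliate, of_apply, tensorChannel_apply, Fintype.sum_prod_type]
    rw [Finset.sum_comm]
    conv_rhs => rw [Finset.sum_comm]
    refine Finset.sum_congr rfl fun i _ => ?_
    rw [Finset.sum_comm]
    refine Finset.sum_congr rfl fun x _ => ?_
    rw [Finset.sum_comm]
    simp only [← Finset.mul_sum]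
    -- Trace preservation only has to be checked on matrix units, where the trace factorizes over
    -- the uses.
    have h1 : ∀ x', ∑ y : Fin l → β, ∏ s, Φ s (single (x s) (x' s) 1) (y s) (y s) =
        if x = x' then 1 else 0 := by
      intro x'
      have := (Finset.prod_univ_sum (fun _ : Fin l => (Finset.univ : Finset β))
        fun s y => Φ s (single (x s) (x' s) 1) y y).symm
      rw [Fintype.piFinset_univ] at this
      rw [this]
      have h2 : ∀ s, ∑ y, Φ s (single (x s) (x' s) 1) y y = if x s = x' s then 1 else 0 := by
        intro s
        have := (hΦ s).tracePreserving (single (x s) (x' s) 1)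
        rw [trace] at this
        simp only [diag_apply] at this
        rw [this]
        split_ifs with hs
        · rw [hs, trace_single_eq_same]
        · exact trace_single_eq_of_ne _ _ _ hs
      simp only [h2, Finset.prod_ite_zero, Finset.prod_const_one, funext_iff, Finset.mem_univ,
        true_imp_iff]
    simp [h1]

/-! ### Pairs of output states -/

section Reachable

variable {α β : Type*} [Fintype α] [DecidableEq α] [Fintype β] [DecidableEq β]

/-- Up to an isometry, the two states are the outputs of `M^{⊗ l}` and `N^{⊗ l}` on a common
input state. -/
def Reachable (M N : Matrix α α ℂ →ₗ[ℂ] Matrix β β ℂ) (l : ℕ) {γ : Type*} [Fintype γ]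
    (σ ρ : Matrix γ γ ℂ) : Prop :=
  ∃ (r : ℕ) (ω : Matrix ((Fin l → α) × Fin r) ((Fin l → α) × Fin r) ℂ)
    (W : Matrix γ ((Fin l → β) × Fin r) ℂ), IsState ω ∧ Wᴴ * W = 1 ∧
    σ = W * ampliate (Fin r) (tensorPower M l) ω * Wᴴ ∧
    ρ = W * ampliate (Fin r) (tensorPower N l) ω * Wᴴ

variable {M N : Matrix α α ℂ →ₗ[ℂ] Matrix β β ℂ}

lemma reachable_output {l r : ℕ} {ω : Matrix ((Fin l → α) × Fin r) ((Fin l → α) × Fin r) ℂ}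
    (hω : IsState ω) : Reachable M N l (ampliate (Fin r) (tensorPower M l) ω)
      (ampliate (Fin r) (tensorPower N l) ω) :=
  ⟨r, ω, 1, hω, by simp, by simp, by simp⟩

lemma Reachable.conj {l : ℕ} {γ δ : Type*} [Fintype γ] [DecidableEq γ] [Fintype δ]
    {σ ρ : Matrix γ γ ℂ}
    (h : Reachable M N l σ ρ) {V : Matrix δ γ ℂ} (hV : Vᴴ * V = 1) :
    Reachable M N l (V * σ * Vᴴ) (V * ρ * Vᴴ) := by
  obtain ⟨r, ω, W, hω, hW, rfl, rfl⟩ := h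
  refine ⟨r, ω, V * W, hω, ?_, ?_, ?_⟩
  · rw [conjTranspose_mul, Matrix.mul_assoc, ← Matrix.mul_assoc Vᴴ, hV, Matrix.one_mul, hW]
  · simp only [conjTranspose_mul, Matrix.mul_assoc]
  · simp only [conjTranspose_mul, Matrix.mul_assoc]

lemma Reachable.submatrix {l : ℕ} {γ δ : Type*} [Fintype γ] [DecidableEq γ] [Fintype δ]
    {σ ρ : Matrix γ γ ℂ}
    (h : Reachable M N l σ ρ) (e : δ ≃ γ) :
    Reachable M N l (σ.submatrix e e) (ρ.submatrix e e) := by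
  have h1 : ∀ X : Matrix γ γ ℂ, (1 : Matrix γ γ ℂ).submatrix e id * X *
      ((1 : Matrix γ γ ℂ).submatrix e id)ᴴ = X.submatrix e e := by
    intro X
    ext i j
    simp [mul_apply, one_apply]
  rw [← h1 σ, ← h1 ρ]
  refine h.conj ?_
  rw [conjTranspose_submatrix, conjTranspose_one, submatrix_mul_equiv, Matrix.mul_one, submatrix_id_id]

lemma isState_conj {γ δ : Type*} [Fintype γ] [Fintype δ] [DecidableEq γ] {ω : Matrix γ γ ℂ}
    (hω : IsState ω) {W : Matrix δ γ ℂ} (hW : Wᴴ * W = 1) : IsState (W * ω * Wᴴ) :=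
  ⟨hω.1.mul_mul_conjTranspose_same W, by
    rw [trace_mul_comm, ← Matrix.mul_assoc, hW, Matrix.one_mul, hω.2]⟩

lemma Reachable.isState (hM : IsChannel M) (hN : IsChannel N) {l : ℕ} {γ : Type*} [Fintype γ]
    {σ ρ : Matrix γ γ ℂ} (h : Reachable M N l σ ρ) : IsState σ ∧ IsState ρ := by
  obtain ⟨r, ω, W, hω, hW, rfl, rfl⟩ := h
  exact ⟨isState_conj (isState_ampliate_tensorChannel (fun _ => hM) hω) hW,
    isState_conj (isState_ampliate_tensorChannel (fun _ => hN) hω) hW⟩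

open Kronecker

/-- Juxtaposition of two families of systems, each with its own reference system. -/
def juxtapose (α : Type*) (l₁ l₂ r₁ r₂ : ℕ) :
    ((Fin l₁ → α) × Fin r₁) × ((Fin l₂ → α) × Fin r₂) ≃ (Fin (l₁ + l₂) → α) × Fin (r₁ * r₂) :=
  (Equiv.prodProdProdComm _ _ _ _).trans (Equiv.prodCongr (Fin.appendEquiv l₁ l₂) finProdFinEquiv)

lemma ampliate_tensorPower_kronecker {β : Type*} (Φ : Matrix α α ℂ →ₗ[ℂ] Matrix β β ℂ) {l₁ l₂ r₁ r₂ : ℕ}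
    (ω₁ : Matrix ((Fin l₁ → α) × Fin r₁) ((Fin l₁ → α) × Fin r₁) ℂ)
    (ω₂ : Matrix ((Fin l₂ → α) × Fin r₂) ((Fin l₂ → α) × Fin r₂) ℂ) :
    (ampliate (Fin (r₁ * r₂)) (tensorPower Φ (l₁ + l₂)) ((ω₁ ⊗ₖ ω₂).submatrix
      (juxtapose α l₁ l₂ r₁ r₂).symm (juxtapose α l₁ l₂ r₁ r₂).symm)).submatrix
        (juxtapose β l₁ l₂ r₁ r₂) (juxtapose β l₁ l₂ r₁ r₂) =
      ampliate (Fin r₁) (tensorPower Φ l₁) ω₁ ⊗ₖ ampliate (Fin r₂) (tensorPower Φ l₂) ω₂ := by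
  ext ⟨⟨y₁, i₁⟩, ⟨y₂, i₂⟩⟩ ⟨⟨y₁', j₁⟩, ⟨y₂', j₂⟩⟩
  simp only [submatrix_apply, ampliate, of_apply, tensorPower, tensorChannel_apply,
    kroneckerMap_apply]
  rw [← (Fin.appendEquiv l₁ l₂).sum_comp]
  simp_rw [← (Fin.appendEquiv l₁ l₂).sum_comp (fun x' : Fin (l₁ + l₂) → α => _ * _)]
  rw [Fintype.sum_prod_type]
  simp only [Fintype.sum_prod_type, Finset.sum_mul_sum]
  refine Finset.sum_congr rfl fun x₁ _ => ?_
  refine Finset.sum_congr rfl fun x₂ _ => ?_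
  refine Finset.sum_congr rfl fun x₁' _ => ?_
  refine Finset.sum_congr rfl fun x₂' _ => ?_
  simp [juxtapose, Fin.appendEquiv, Fin.prod_univ_add]
  ring

/-- The product of the two inputs is a legal input for `l₁ + l₂` uses once the two references are
merged into one and the factors are regrouped. The tensor power channel sends it to the product of
the outputs. -/
lemma Reachable.kronecker {l₁ l₂ : ℕ} {γ₁ γ₂ : Type*} [Fintype γ₁] [Fintype γ₂]
    {σ₁ ρ₁ : Matrix γ₁ γ₁ ℂ} {σ₂ ρ₂ : Matrix γ₂ γ₂ ℂ} (h₁ : Reachable M N l₁ σ₁ ρ₁)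
    (h₂ : Reachable M N l₂ σ₂ ρ₂) : Reachable M N (l₁ + l₂) (σ₁ ⊗ₖ σ₂) (ρ₁ ⊗ₖ ρ₂) := by
  obtain ⟨r₁, ω₁, W₁, hω₁, hW₁, rfl, rfl⟩ := h₁
  obtain ⟨r₂, ω₂, W₂, hω₂, hW₂, rfl, rfl⟩ := h₂
  have hr : ∀ Φ : Matrix α α ℂ →ₗ[ℂ] Matrix β β ℂ,
      (W₁ * ampliate (Fin r₁) (tensorPower Φ l₁) ω₁ * W₁ᴴ) ⊗ₖ
        (W₂ * ampliate (Fin r₂) (tensorPower Φ l₂) ω₂ * W₂ᴴ) =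
      (W₁ ⊗ₖ W₂) * (ampliate (Fin (r₁ * r₂)) (tensorPower Φ (l₁ + l₂)) ((ω₁ ⊗ₖ ω₂).submatrix
        (juxtapose α l₁ l₂ r₁ r₂).symm (juxtapose α l₁ l₂ r₁ r₂).symm)).submatrix
        (juxtapose β l₁ l₂ r₁ r₂) (juxtapose β l₁ l₂ r₁ r₂) * (W₁ ⊗ₖ W₂)ᴴ := by
    intro Φ
    rw [ampliate_tensorPower_kronecker, conjTranspose_kronecker, mul_kronecker_mul,
      mul_kronecker_mul]
  rw [hr, hr]
  refine Reachable.conj (Reachable.submatrix (reachable_output ?_) _) ?_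
  · constructor
    · exact (hω₁.1.kronecker hω₂.1).submatrix _
    · rw [trace]
      simp only [diag_apply, submatrix_apply]
      rw [(juxtapose α l₁ l₂ r₁ r₂).symm.sum_comp fun z => (ω₁ ⊗ₖ ω₂) z z]
      have := trace_kronecker ω₁ ω₂
      rw [hω₁.2, hω₂.2, one_mul] at this
      exact this
  · rw [conjTranspose_kronecker, ← mul_kronecker_mul, hW₁, hW₂, one_kronecker_one]

/-- The tensor power of an operator. -/
def tpow {γ : Type*} (σ : Matrix γ γ ℂ) (k : ℕ) : Matrix (Fin k → γ) (Fin k → γ) ℂ :=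
  Matrix.of fun x y => ∏ i, σ (x i) (y i)

lemma tpow_succ {γ : Type*} (σ : Matrix γ γ ℂ) (k : ℕ) :
    tpow σ (k + 1) = (σ ⊗ₖ tpow σ k).submatrix (Fin.consEquiv fun _ => γ).symm
      (Fin.consEquiv fun _ => γ).symm := by
  ext x y
  simp [tpow, Fin.prod_univ_succ, Fin.consEquiv, Fin.tail]

lemma Reachable.tensor_pow {l : ℕ} {γ : Type*} [Fintype γ] [DecidableEq γ] {σ ρ : Matrix γ γ ℂ}
    (h : Reachable M N l σ ρ) (k : ℕ) : Reachable M N (k * l) (tpow σ k) (tpow ρ k) := by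
  induction k with
  | zero =>
    -- With no uses, all spaces are one-dimensional and both outputs are the scalar `1`.
    have hz : ∀ Φ : Matrix α α ℂ →ₗ[ℂ] Matrix β β ℂ,
        ampliate (Fin 1) (tensorPower Φ 0) (1 : Matrix ((Fin 0 → α) × Fin 1) _ ℂ) = 1 := by
      intro Φ
      ext ⟨y, i⟩ ⟨y', j⟩
      obtain rfl := Subsingleton.elim y y'
      obtain rfl := Subsingleton.elim i j
      simp [ampliate, tensorPower, tensorChannel_apply]
    have hp : ∀ τ : Matrix γ γ ℂ, tpow τ 0 =
        (1 : Matrix ((Fin 0 → β) × Fin 1) ((Fin 0 → β) × Fin 1) ℂ).submatrix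
          ((Equiv.ofUnique (Fin 0 → γ) (Fin 0 → β)).trans (Equiv.prodUnique _ (Fin 1)).symm)
          ((Equiv.ofUnique (Fin 0 → γ) (Fin 0 → β)).trans (Equiv.prodUnique _ (Fin 1)).symm) := by
      intro τ
      ext x y
      simp [tpow, Subsingleton.elim x y]
    rw [Nat.zero_mul, hp, hp]
    refine Reachable.submatrix ?_ _
    have := reachable_output (M := M) (N := N)
      (ω := (1 : Matrix ((Fin 0 → α) × Fin 1) _ ℂ)) ⟨PosSemidef.one, by simp⟩
    rwa [hz, hz] at this
  | succ k ih =>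
    rw [tpow_succ, tpow_succ, Nat.succ_mul, Nat.add_comm]
    exact (h.kronecker ih).submatrix _

/-! ### The measured channel relative entropy -/

lemma measuredRelEntropy_eq {γ : Type*} [Fintype γ] [DecidableEq γ] {m : ℕ} (E : POVM γ m)
    {σ ρ : Matrix γ γ ℂ} (hσ : IsState σ) (hρ : IsState ρ) :
    InformationTheory.klDiv (bornLaw E σ) (bornLaw E ρ) =
      klFin (fun x => (E.effect x * σ).trace.re) (fun x => (E.effect x * ρ).trace.re) := by
  have h1 : ∀ {τ : Matrix γ γ ℂ}, IsState τ → ∑ x, (E.effect x * τ).trace.re = 1 := by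
    intro τ hτ
    rw [← Complex.re_sum, ← trace_sum, ← Finset.sum_mul, E.sum_eq_one, one_mul, hτ.2,
      Complex.one_re]
  exact klDiv_finLaw (fun x => trace_mul_nonneg (E.posSemidef x) hσ.1) (h1 hσ)
    (fun x => trace_mul_nonneg (E.posSemidef x) hρ.1) (h1 hρ)

/-- The measured channel relative entropy of `l`-fold tensor powers is at most the relative
entropy. -/
lemma measuredChannelRelEntropy_le (hM : IsChannel M) (hN : IsChannel N) (l : ℕ) :
    measuredChannelRelEntropy (tensorPower M l) (tensorPower N l) ≤
      channelRelEntropy (tensorPower M l) (tensorPower N l) := by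
  refine iSup_mono fun r => iSup_mono fun ω => iSup_mono fun hω => iSup_le fun m => iSup_le fun E =>
    ?_
  obtain ⟨h1, h2⟩ := (reachable_output (M := M) (N := N) hω).isState hM hN
  rw [measuredRelEntropy_eq E h1 h2]
  exact klFin_le_relEntropy E.posSemidef E.sum_eq_one h1 h2.1

lemma klFin_comp_equiv {ι κ : Type*} [Fintype ι] [Fintype κ] (e : κ ≃ ι) (q p : ι → ℝ) :
    klFin (fun x => q (e x)) (fun x => p (e x)) = klFin q p := by
  simp only [klFin, e.forall_congr_left, Equiv.apply_symm_apply]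
  rw [e.sum_comp fun x => q x * Real.log (q x / p x)]

/-- Pulling the effects back along the isometry, `Wᴴ E W`, gives a measurement of the actual outputs
with the same statistics. Hence isometries and relabelled outcomes gain nothing beyond the supremum.
-/
lemma Reachable.klFin_le (hM : IsChannel M) (hN : IsChannel N) {l : ℕ} {γ : Type*} [Fintype γ]
    [DecidableEq γ] {σ ρ : Matrix γ γ ℂ} (h : Reachable M N l σ ρ) {ι : Type*} [Fintype ι]
    {E : ι → Matrix γ γ ℂ} (hE : ∀ x, (E x).PosSemidef) (hE1 : ∑ x, E x = 1) :
    klFin (fun x => (E x * σ).trace.re) (fun x => (E x * ρ).trace.re) ≤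
      measuredChannelRelEntropy (tensorPower M l) (tensorPower N l) := by
  obtain ⟨r, ω, W, hω, hW, rfl, rfl⟩ := h
  set e := (Fintype.equivFin ι).symm
  let F : POVM ((Fin l → β) × Fin r) (Fintype.card ι) :=
    { effect := fun x => Wᴴ * E (e x) * W
      posSemidef := fun x => (hE _).conjTranspose_mul_mul_same W
      sum_eq_one := by
        rw [← Matrix.sum_mul, ← Matrix.mul_sum, e.sum_comp E, hE1, Matrix.mul_one, hW] }
  have hF : ∀ X x, (F.effect x * X).trace = (E (e x) * (W * X * Wᴴ)).trace := by
    intro X x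
    rw [← Matrix.mul_assoc, trace_mul_comm _ Wᴴ]
    simp only [F, Matrix.mul_assoc]
  obtain ⟨h1, h2⟩ := (reachable_output (M := M) (N := N) hω).isState hM hN
  have h3 := measuredRelEntropy_eq F h1 h2
  simp only [hF] at h3
  rw [klFin_comp_equiv e (fun x => (E x * (W * ampliate (Fin r) (tensorPower M l) ω * Wᴴ)).trace.re)
    (fun x => (E x * (W * ampliate (Fin r) (tensorPower N l) ω * Wᴴ)).trace.re)] at h3
  rw [← h3]
  exact le_iSup_of_le r <| le_iSup_of_le ω <| le_iSup_of_le hω <|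
    le_iSup₂_of_le (Fintype.card ι) F le_rfl

end Reachable

end ChangePoint

namespace ChangePoint

open Matrix

/-! ### Pinching -/

/-- Cauchy–Schwarz. Applied to the components of a vector in the pinching subspaces, it yields the
pinching inequality, with the number of subspaces as constant. -/
lemma normSq_sum_le {ι : Type*} [Fintype ι] (f : ι → ℂ) :
    Complex.normSq (∑ c, f c) ≤ Fintype.card ι * ∑ c, Complex.normSq (f c) := by
  simp only [Complex.normSq_apply, Complex.re_sum, Complex.im_sum, Finset.sum_add_distrib, mul_add,
    ← sq]
  exact add_le_add sq_sum_le_card_mul_sum_sq sq_sum_le_card_mul_sum_sq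

/-- If an operator with eigenvalues `a` is dominated by `v` times an operator with eigenvalues `q`,
where `q` is the diagonal of the former in the eigenbasis of the latter, then the entropy of `q`
exceeds that of `a` by at most `log v`. -/
lemma sum_mul_log_sub_le {δ ι : Type*} [Fintype δ] [Fintype ι] [DecidableEq δ] [DecidableEq ι]
    {A : Matrix δ ι ℂ} (hA : A * Aᴴ = 1) {a : δ → ℝ} (ha : ∀ i, 0 ≤ a i) (ha1 : ∑ i, a i = 1)
    {q : ι → ℝ} (hq : ∀ y, q y = ∑ i, a i * Complex.normSq (A i y))
    (horth : ∀ y y', q y ≠ 0 → q y' ≠ 0 → (Aᴴ * A) y y' = if y = y' then 1 else 0)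
    {v : ℝ} (hv : 0 < v)
    (hle : ∀ z : δ → ℂ, ∑ i, a i * Complex.normSq (z i) ≤
      v * ∑ y, q y * Complex.normSq ((Aᴴ *ᵥ z) y)) :
    ∑ i, a i * Real.log (a i) - Real.log v ≤ ∑ y, q y * Real.log (q y) := by
  have hq0 : ∀ y, 0 ≤ q y := fun y => by
    rw [hq]; exact Finset.sum_nonneg fun i _ => mul_nonneg (ha i) (Complex.normSq_nonneg _)
  -- The operator inequality is tested on `z = A c` with `c y = conj (A i y) / q y`. It gives `a i
  -- t² ≤ v t`. Division by zero makes `c` vanish where `q y = 0`, so only the orthonormal columns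
  -- enter.
  have key : ∀ i, a i * ∑ y, Complex.normSq (A i y) / q y ≤ v := by
    intro i
    set t := ∑ y, Complex.normSq (A i y) / q y with ht
    set c : ι → ℂ := fun y => star (A i y) / (q y : ℂ) with hc
    have h1 : (A *ᵥ c) i = (t : ℂ) := by
      rw [mulVec, dotProduct, ht]
      push_cast
      refine Finset.sum_congr rfl fun y _ => ?_
      rw [hc, Complex.normSq_eq_conj_mul_self, Complex.star_def]
      ring
    have h2 : ∀ y, q y * Complex.normSq ((Aᴴ *ᵥ (A *ᵥ c)) y) = Complex.normSq (A i y) / q y := by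
      intro y
      by_cases hy : q y = 0
      · simp [hy]
      have : (Aᴴ *ᵥ (A *ᵥ c)) y = c y := by
        rw [mulVec_mulVec, mulVec, dotProduct, Finset.sum_eq_single y]
        · rw [horth y y hy hy, if_pos rfl, one_mul]
        · intro y' _ hne
          by_cases hy' : q y' = 0
          · simp [hc, hy']
          · rw [horth y y' hy hy', if_neg hne.symm, zero_mul]
        · simp
      rw [this, hc]
      simp only [Complex.normSq_div, Complex.star_def, Complex.normSq_conj, Complex.normSq_ofReal]
      field_simp
    have h3 := hle (A *ᵥ c)
    simp only [h2] at h3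
    rw [← ht] at h3
    have h4 : a i * Complex.normSq ((A *ᵥ c) i) ≤ ∑ i, a i * Complex.normSq ((A *ᵥ c) i) :=
      Finset.single_le_sum (f := fun i => a i * Complex.normSq ((A *ᵥ c) i))
        (fun j _ => mul_nonneg (ha j) (Complex.normSq_nonneg _)) (Finset.mem_univ i)
    rw [h1, Complex.normSq_ofReal] at h4
    have ht0 : 0 ≤ t := Finset.sum_nonneg fun y _ => div_nonneg (Complex.normSq_nonneg _) (hq0 y)
    rcases ht0.eq_or_lt with h0 | h0
    · rw [← h0, mul_zero]; exact hv.le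
    · refine le_of_mul_le_mul_right ?_ h0
      linarith
  -- This is `log x ≤ x - 1` at `x = a i / (q y v)`, weighted by `a i |A i y|²`. After summation
  -- over `y`, `key` makes the first term at most `a i` and leaves `a i log v`. No operator
  -- monotonicity of the logarithm is needed.
  have hterm : ∀ i y, a i * Complex.normSq (A i y) * (Real.log (a i) - Real.log (q y)) ≤
      a i * (a i * (Complex.normSq (A i y) / q y)) / v +
        a i * Complex.normSq (A i y) * (Real.log v - 1) := by
    intro i y
    have hn := Complex.normSq_nonneg (A i y)
    rcases (mul_nonneg (ha i) hn).eq_or_lt with h0 | h0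
    · rw [← h0, zero_mul, zero_mul, add_zero]
      exact div_nonneg (mul_nonneg (ha i) (mul_nonneg (ha i) (div_nonneg hn (hq0 y)))) hv.le
    · have hai : 0 < a i := (ha i).lt_of_ne' fun h => by simp [h] at h0
      have hqy : 0 < q y := by
        rw [hq]
        exact h0.trans_le (Finset.single_le_sum (f := fun i => a i * Complex.normSq (A i y))
          (fun j _ => mul_nonneg (ha j) (Complex.normSq_nonneg _)) (Finset.mem_univ i))
      have h1 := Real.log_le_sub_one_of_pos (x := a i / q y / v) (by positivity)
      rw [Real.log_div (by positivity) hv.ne', Real.log_div hai.ne' hqy.ne'] at h1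
      have h2 := mul_le_mul_of_nonneg_left h1 h0.le
      have h3 : a i * (a i * (Complex.normSq (A i y) / q y)) / v =
        a i * Complex.normSq (A i y) * (a i / q y / v) := by ring
      rw [h3]
      linarith
  have hrow := sum_normSq_of_mul_conjTranspose hA
  have hL : ∑ i, ∑ y, a i * Complex.normSq (A i y) * (Real.log (a i) - Real.log (q y)) =
      ∑ i, a i * Real.log (a i) - ∑ y, q y * Real.log (q y) := by
    simp only [mul_sub, Finset.sum_sub_distrib]
    congr 1
    · refine Finset.sum_congr rfl fun i _ => ?_
      rw [← Finset.sum_mul, ← Finset.mul_sum, hrow, mul_one]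
    · rw [Finset.sum_comm]
      refine Finset.sum_congr rfl fun y _ => ?_
      rw [← Finset.sum_mul, ← hq]
  have hR : ∑ i, ∑ y, (a i * (a i * (Complex.normSq (A i y) / q y)) / v +
        a i * Complex.normSq (A i y) * (Real.log v - 1)) ≤ Real.log v := by
    have : ∀ i, ∑ y, (a i * (a i * (Complex.normSq (A i y) / q y)) / v +
        a i * Complex.normSq (A i y) * (Real.log v - 1)) ≤ a i * Real.log v := by
      intro i
      rw [Finset.sum_add_distrib, ← Finset.sum_mul, ← Finset.mul_sum, hrow, ← Finset.sum_div,
        ← Finset.mul_sum, ← Finset.mul_sum]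
      have h1 := mul_le_mul_of_nonneg_left (key i) (ha i)
      have h2 := (div_le_iff₀ hv).2 h1
      linarith
    refine (Finset.sum_le_sum fun i _ => this i).trans_eq ?_
    rw [← Finset.sum_mul, ha1, one_mul]
  have := (Finset.sum_le_sum fun i _ => Finset.sum_le_sum fun y _ => hterm i y).trans hR
  rw [hL] at this
  linarith

lemma conj_diagonal_dotProduct {δ : Type*} [Fintype δ] [DecidableEq δ] (U : Matrix δ δ ℂ)
    (a : δ → ℝ) (z : δ → ℂ) :
    star z ⬝ᵥ ((U * diagonal (fun i => (a i : ℂ)) * Uᴴ) *ᵥ z) =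
      ((∑ i, a i * Complex.normSq ((Uᴴ *ᵥ z) i) : ℝ) : ℂ) := by
  rw [← mulVec_mulVec, ← mulVec_mulVec, dotProduct_mulVec,
    show star z ᵥ* U = star (Uᴴ *ᵥ z) by rw [star_mulVec, conjTranspose_conjTranspose], dotProduct]
  push_cast
  refine Finset.sum_congr rfl fun i _ => ?_
  rw [mulVec_diagonal, Complex.normSq_eq_conj_mul_self, Pi.star_apply, Complex.star_def]
  ring

/-- The measurement in a common eigenbasis of `ρ` and of the operator obtained from `S` by pinching
with respect to the eigenspaces of `ρ` loses at most the logarithm of their number. -/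
lemma exists_pinching_measurement {δ C : Type*} [Fintype δ] [DecidableEq δ] [Fintype C]
    [DecidableEq C] [Nonempty C] {S : Matrix δ δ ℂ} (hS : S.PosSemidef) {U : Matrix δ δ ℂ}
    {a : δ → ℝ} (hU : Uᴴ * U = 1) (hU' : U * Uᴴ = 1) (ha : ∀ i, 0 ≤ a i) (ha1 : ∑ i, a i = 1)
    (hSe : S = U * diagonal (fun i => (a i : ℂ)) * Uᴴ) (τ : δ → C) (b : C → ℝ) :
    ∃ E : C × δ → Matrix δ δ ℂ, (∀ y, (E y).PosSemidef) ∧ ∑ y, E y = 1 ∧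
      ENNReal.ofReal (∑ i, a i * Real.log (a i) - Real.log (Fintype.card C) -
          ∑ x, (S x x).re * Real.log (b (τ x))) ≤
        klFin (fun y => (E y * S).trace.re)
          (fun y => (E y * diagonal fun x => (b (τ x) : ℂ)).trace.re) := by
  set P : C → Matrix δ δ ℂ := fun c => diagonal fun x => if τ x = c then 1 else 0 with hP
  have hPh : ∀ c, (P c)ᴴ = P c := by
    intro c
    simp only [hP, diagonal_conjTranspose]
    congr 1
    ext x
    simp [apply_ite star]
  have hPP : ∀ c, P c * P c = P c := by
    intro c
    simp [hP, diagonal_mul_diagonal]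
  have hP1 : ∑ c, P c = 1 := by
    ext x x'
    rw [Matrix.sum_apply]
    by_cases h : x = x' <;> simp [hP, one_apply, h]
  have hpin : ∀ c, (P c * S * P c).PosSemidef := fun c => by
    have := hS.mul_mul_conjTranspose_same (P c)
    rwa [hPh] at this
  choose V lam hV hV' hlam hVe hVl using fun c => exists_spectral_decomposition (hpin c)
  -- The eigenvectors of each block `P c S P c` are projected back by `P c`. Those with nonzero
  -- eigenvalue already lie in the range of `P c` and do not change. The null ones may be shortened,
  -- but this makes the rank-one operators of all blocks together sum to `∑ P c = 1`.
  set w : C × δ → δ → ℂ := fun y => P y.1 *ᵥ (V y.1).col y.2 with hw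
  set Wm : Matrix δ (C × δ) ℂ := Matrix.of fun x y => w y x with hWm
  have hWm1 : Wm * Wmᴴ = 1 := by
    have h1 : ∀ c, (P c * V c) * (P c * V c)ᴴ = P c := by
      intro c
      rw [conjTranspose_mul, mul_assoc, ← mul_assoc (V c), hV', one_mul, hPh, hPP]
    rw [← hP1]
    ext x x'
    rw [mul_apply, Fintype.sum_prod_type, Matrix.sum_apply]
    refine Finset.sum_congr rfl fun c _ => ?_
    rw [← h1 c, mul_apply]
    rfl
  have hfix : ∀ y, lam y.1 y.2 ≠ 0 → w y = (V y.1).col y.2 := by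
    rintro ⟨c, i⟩ hy
    have h1 : (P c * S * P c) *ᵥ (V c).col i = (lam c i : ℂ) • (V c).col i := by
      rw [hVe c, ← mulVec_single_one, mulVec_mulVec, mul_assoc, hV, mul_one, ← mulVec_mulVec]
      ext x
      simp [mul_comm]
    have h2 : P c *ᵥ ((lam c i : ℂ) • (V c).col i) = (lam c i : ℂ) • (V c).col i := by
      rw [← h1, mulVec_mulVec, ← mul_assoc, ← mul_assoc, hPP]
    rw [mulVec_smul] at h2
    exact smul_right_injective _ (Complex.ofReal_ne_zero.2 hy) h2
  set E : C × δ → Matrix δ δ ℂ := fun y => vecMulVec (w y) (star (w y)) with hE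
  have hEt : ∀ y X, (E y * X).trace = star (w y) ⬝ᵥ (X *ᵥ w y) := by
    intro y X
    rw [hE, vecMulVec_mul, trace_vecMulVec, dotProduct_mulVec, dotProduct_comm]
  have hqc : ∀ y, star (w y) ⬝ᵥ (S *ᵥ w y) = (lam y.1 y.2 : ℂ) := by
    rintro ⟨c, i⟩
    have h1 : star (w (c, i)) ⬝ᵥ (S *ᵥ w (c, i)) = ((V c)ᴴ * (P c * S * P c) * V c) i i := by
      rw [hw]
      simp only [star_mulVec, hPh, ← dotProduct_mulVec, mulVec_mulVec]
      rw [Matrix.mul_assoc, mul_apply, dotProduct]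
      refine Finset.sum_congr rfl fun x _ => ?_
      rw [← mul_assoc]
      rfl
    rw [h1, hVe c]
    simp only [mul_assoc, hV, mul_one]
    rw [← mul_assoc, hV, one_mul, diagonal_apply_eq]
  have hq : ∀ y, (E y * S).trace.re = lam y.1 y.2 := by
    intro y
    rw [hEt, hqc, Complex.ofReal_re]
  have horthW : ∀ y y', lam y.1 y.2 ≠ 0 → lam y'.1 y'.2 ≠ 0 →
      (Wmᴴ * Wm) y y' = if y = y' then 1 else 0 := by
    rintro ⟨c, i⟩ ⟨c', i'⟩ hy hy'
    have h0 : (Wmᴴ * Wm) (c, i) (c', i') = star (w (c, i)) ⬝ᵥ w (c', i') := rfl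
    rw [h0]
    by_cases hc : c = c'
    · subst hc
      rw [hfix _ hy, hfix _ hy']
      have := congrFun (congrFun (hV c) i) i'
      rw [one_apply] at this
      simp only [Prod.mk.injEq, true_and]
      exact this
    · rw [if_neg fun h => hc (Prod.mk.inj h).1]
      refine Finset.sum_eq_zero fun x _ => ?_
      simp only [hw, hP, mulVec_diagonal, Pi.star_apply]
      by_cases hx : τ x = c
      · have : τ x ≠ c' := fun h => hc (hx.symm.trans h)
        simp [this]
      · simp [hx]
  refine ⟨E, fun y => posSemidef_vecMulVec_self_star _, ?_, ?_⟩
  · rw [← hWm1]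
    ext x x'
    rw [Matrix.sum_apply, mul_apply]
    rfl
  have hA : (Uᴴ * Wm) * (Uᴴ * Wm)ᴴ = 1 := by
    rw [conjTranspose_mul, conjTranspose_conjTranspose, Matrix.mul_assoc, ← Matrix.mul_assoc Wm,
      hWm1, Matrix.one_mul, hU]
  have hent := sum_mul_log_sub_le hA ha ha1 (q := fun y => lam y.1 y.2) (v := Fintype.card C)
    (by
      intro y
      have h1 := conj_diagonal_dotProduct U a (w y)
      rw [← hSe, hqc] at h1
      exact Complex.ofReal_injective h1)
    (by
      intro y y' hy hy'
      rw [conjTranspose_mul, conjTranspose_conjTranspose, Matrix.mul_assoc, ← Matrix.mul_assoc U,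
        hU', Matrix.one_mul]
      exact horthW y y' hy hy')
    (by exact_mod_cast Fintype.card_pos)
    (by
      intro z
      set z' := U *ᵥ z with hz'
      have hz : z = Uᴴ *ᵥ z' := by rw [hz', mulVec_mulVec, hU, one_mulVec]
      have hAz : (Uᴴ * Wm)ᴴ *ᵥ z = Wmᴴ *ᵥ z' := by
        rw [conjTranspose_mul, conjTranspose_conjTranspose, ← mulVec_mulVec]
      -- Splitting the vector into its components in the ranges of `P c` and applying Cauchy–Schwarz
      -- is the pinching inequality `S ≤ |C| ∑ P c S P c`, evaluated at one vector.
      have hsplit : ∀ i, z i = ∑ c, (Uᴴ *ᵥ (P c *ᵥ z')) i := by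
        intro i
        rw [← Finset.sum_apply, ← mulVec_sum, ← sum_mulVec, hP1, one_mulVec, ← hz]
      have hc : ∀ c, ∑ i, a i * Complex.normSq ((Uᴴ *ᵥ (P c *ᵥ z')) i) =
          ∑ i, lam c i * Complex.normSq ((Wmᴴ *ᵥ z') (c, i)) := by
        intro c
        have h1 := conj_diagonal_dotProduct U a (P c *ᵥ z')
        have h2 := conj_diagonal_dotProduct (V c) (lam c) z'
        rw [← hSe, star_mulVec, hPh, ← dotProduct_mulVec, mulVec_mulVec, mulVec_mulVec,
          hVe, h2] at h1
        rw [← Complex.ofReal_injective h1]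
        refine Finset.sum_congr rfl fun i _ => ?_
        by_cases h0 : lam c i = 0
        · simp [h0]
        · have : ((V c)ᴴ *ᵥ z') i = (Wmᴴ *ᵥ z') (c, i) := by
            have h3 := hfix (c, i) h0
            refine Finset.sum_congr rfl fun x _ => ?_
            change star (V c x i) * z' x = star (w (c, i) x) * z' x
            rw [h3]
            rfl
          rw [this]
      rw [hAz, Fintype.sum_prod_type]
      simp only [← hc]
      rw [Finset.sum_comm, Finset.mul_sum]
      refine Finset.sum_le_sum fun i _ => ?_
      rw [← Finset.mul_sum, mul_left_comm, hsplit]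
      exact mul_le_mul_of_nonneg_left (normSq_sum_le _) (ha i))
  unfold klFin
  split_ifs with hac
  swap
  · exact le_top
  refine ENNReal.ofReal_le_ofReal ?_
  rw [sum_mul_log_div hac]
  simp only [hq] at hac ⊢
  -- The vectors of block `c` are eigenvectors of the diagonal operator with eigenvalue `b c`, of
  -- norm one where they carry weight. Pinching therefore leaves the cross term unchanged and only
  -- the entropy term pays.
  have hp : ∑ y : C × δ, lam y.1 y.2 * Real.log (E y * diagonal fun x => (b (τ x) : ℂ)).trace.re =
      ∑ x, (S x x).re * Real.log (b (τ x)) := by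
    have h1 : ∀ y : C × δ, lam y.1 y.2 * Real.log (E y * diagonal fun x => (b (τ x) : ℂ)).trace.re =
        lam y.1 y.2 * Real.log (b y.1) := by
      rintro ⟨c, i⟩
      by_cases h0 : lam c i = 0
      · simp [h0]
      have h2 : (diagonal fun x => (b (τ x) : ℂ)) *ᵥ w (c, i) = (b c : ℂ) • w (c, i) := by
        ext x
        simp only [hw, hP, mulVec_diagonal, Pi.smul_apply, smul_eq_mul]
        by_cases hx : τ x = c <;> simp [hx]
      have h3 : star (w (c, i)) ⬝ᵥ w (c, i) = 1 := by
        have := horthW (c, i) (c, i) h0 h0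
        rwa [if_pos rfl] at this
      rw [hEt, h2, dotProduct_smul, h3, smul_eq_mul, mul_one, Complex.ofReal_re]
    simp only [h1, Fintype.sum_prod_type, ← Finset.sum_mul]
    have h4 : ∀ c, ∑ i, lam c i = ∑ x, if τ x = c then (S x x).re else 0 := by
      intro c
      have h5 := congrArg (fun X => (trace X).re) (hVe c)
      simp only [trace_diag_conj (hV c), Complex.re_sum, Complex.ofReal_re] at h5
      rw [← h5, trace, Complex.re_sum]
      refine Finset.sum_congr rfl fun x _ => ?_
      simp only [hP, diag_apply, mul_diagonal, diagonal_mul]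
      split_ifs <;> simp
    simp only [h4, Finset.sum_mul]
    rw [Finset.sum_comm]
    refine Finset.sum_congr rfl fun x _ => ?_
    simp [ite_mul]
  rw [hp]
  linarith

end ChangePoint

namespace ChangePoint

open Matrix

/-! ### Tensor powers -/

lemma tpow_mul {γ : Type*} [Fintype γ] (A B : Matrix γ γ ℂ) (k : ℕ) :
    tpow (A * B) k = tpow A k * tpow B k := by
  ext x y
  simp only [tpow, of_apply, mul_apply, Finset.prod_univ_sum, Fintype.piFinset_univ,
    Finset.prod_mul_distrib]

lemma tpow_conjTranspose {γ : Type*} (A : Matrix γ γ ℂ) (k : ℕ) : tpow Aᴴ k = (tpow A k)ᴴ := by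
  ext x y
  simp [tpow, star_prod]

lemma tpow_diagonal {γ : Type*} [DecidableEq γ] (d : γ → ℂ) (k : ℕ) :
    tpow (diagonal d) k = diagonal fun x => ∏ i, d (x i) := by
  ext x y
  simp only [tpow, of_apply, diagonal_apply, Finset.prod_ite_zero, Finset.mem_univ, true_imp_iff,
    funext_iff]

lemma tpow_one {γ : Type*} [DecidableEq γ] (k : ℕ) : tpow (1 : Matrix γ γ ℂ) k = 1 := by
  rw [← diagonal_one, tpow_diagonal]
  simp

lemma sum_prod_mul_eval {γ : Type*} [Fintype γ] {k : ℕ} {p : γ → ℝ} (hp : ∑ g, p g = 1)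
    (f : γ → ℝ) (i : Fin k) : ∑ x : Fin k → γ, (∏ j, p (x j)) * f (x i) = ∑ g, p g * f g := by
  classical
  have h := Finset.prod_univ_sum (fun _ : Fin k => (Finset.univ : Finset γ))
    fun j g => p g * if j = i then f g else 1
  rw [Fintype.piFinset_univ] at h
  simp only [Finset.prod_mul_distrib, Finset.prod_ite_eq', Finset.mem_univ, if_true] at h
  rw [← h, Finset.prod_eq_single i]
  · simp
  · intro j _ hj
    simp [hj, hp]
  · simp

/-- The logarithm of the product splits only if no factor vanishes, since `log 0 = 0` by default.
Where a factor of `f` vanishes, so does the weight. -/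
lemma sum_prod_mul_log {γ : Type*} [Fintype γ] (k : ℕ) {p f : γ → ℝ} (hp : ∑ g, p g = 1)
    (hf : ∀ g, f g = 0 → p g = 0) :
    ∑ x : Fin k → γ, (∏ j, p (x j)) * Real.log (∏ j, f (x j)) =
      k * ∑ g, p g * Real.log (f g) := by
  have h1 : ∀ x : Fin k → γ, (∏ j, p (x j)) * Real.log (∏ j, f (x j)) =
      ∑ i, (∏ j, p (x j)) * Real.log (f (x i)) := by
    intro x
    by_cases h0 : ∀ j, f (x j) ≠ 0
    · rw [Real.log_prod fun j _ => h0 j, Finset.mul_sum]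
    · push Not at h0
      obtain ⟨j, hj⟩ := h0
      simp [Finset.prod_eq_zero (f := fun j => p (x j)) (Finset.mem_univ j) (hf _ hj)]
  simp only [h1]
  rw [Finset.sum_comm]
  simp only [sum_prod_mul_eval hp fun g => Real.log (f g)]
  simp

lemma sum_prod_eq_one {γ : Type*} [Fintype γ] (k : ℕ) {p : γ → ℝ} (hp : ∑ g, p g = 1) :
    ∑ x : Fin k → γ, ∏ j, p (x j) = 1 := by
  classical
  have h := Finset.prod_univ_sum (fun _ : Fin k => (Finset.univ : Finset γ)) fun _ g => p g
  rw [Fintype.piFinset_univ] at h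
  simp [← h, hp]

/-! ### Attaining the relative entropy by measuring many copies -/

section Regularization

variable {α β : Type*} [Fintype α] [DecidableEq α] [Fintype β] [DecidableEq β]
  {M N : Matrix α α ℂ →ₗ[ℂ] Matrix β β ℂ}

/-- The pinched measurement of many copies of a pair of reachable states. -/
lemma Reachable.ofReal_le (hM : IsChannel M) (hN : IsChannel N) {l : ℕ} {γ : Type*} [Fintype γ]
    [DecidableEq γ] {S : Matrix γ γ ℂ} {b a : γ → ℝ} {U : Matrix γ γ ℂ}
    (h : Reachable M N l S (diagonal fun i => (b i : ℂ))) (hU : Uᴴ * U = 1) (hU' : U * Uᴴ = 1)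
    (ha : ∀ i, 0 ≤ a i) (hSe : S = U * diagonal (fun i => (a i : ℂ)) * Uᴴ)
    (hsupp : ∀ g, b g = 0 → S g g = 0) (k : ℕ) :
    ENNReal.ofReal (k * (∑ i, a i * Real.log (a i) - ∑ g, (S g g).re * Real.log (b g)) -
        Fintype.card γ * Real.log (k + 1)) ≤
      measuredChannelRelEntropy (tensorPower M (k * l)) (tensorPower N (k * l)) := by
  have hS := (h.isState hM hN).1
  have hSk := ((h.tensor_pow k).isState hM hN).1
  have ha1 : ∑ i, a i = 1 := by
    have := hS.2
    rw [hSe, trace_diag_conj hU] at this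
    exact_mod_cast this
  have hSg : ∀ g, S g g = ((S g g).re : ℂ) := fun g => by
    have := (Complex.nonneg_iff.1 (hS.1.diag_nonneg (i := g))).2
    exact Complex.ext rfl (by simp [← this])
  -- The type of a sequence, which counts its letters. The eigenvalue `∏ b (x i)` depends on the
  -- type only, and at most `(k + 1) ^ |γ|` types give the loss `|γ| log (k + 1)`.
  let τ : (Fin k → γ) → γ → Fin (k + 1) := fun x g =>
    ⟨(Finset.univ.filter fun i => x i = g).card, Nat.lt_succ_of_le <| by
      simpa using Finset.card_le_univ (Finset.univ.filter fun i => x i = g)⟩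
  let b' : (γ → Fin (k + 1)) → ℝ := fun c => ∏ g, b g ^ (c g : ℕ)
  have hb' : ∀ x : Fin k → γ, ∏ i, b (x i) = b' (τ x) := by
    intro x
    rw [← Finset.prod_fiberwise Finset.univ x]
    refine Finset.prod_congr rfl fun g _ => ?_
    rw [Finset.prod_congr rfl fun i hi => by rw [(Finset.mem_filter.1 hi).2],
      Finset.prod_const]
  obtain ⟨E, hE, hE1, hle⟩ := exists_pinching_measurement hSk.1 (U := tpow U k)
    (a := fun x => ∏ i, a (x i))
    (by rw [← tpow_conjTranspose, ← tpow_mul, hU, tpow_one])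
    (by rw [← tpow_conjTranspose, ← tpow_mul, hU', tpow_one])
    (fun x => Finset.prod_nonneg fun i _ => ha _) (sum_prod_eq_one k ha1)
    (by
      rw [hSe, tpow_mul, tpow_mul, tpow_conjTranspose, tpow_diagonal]
      push_cast
      rfl) τ b'
  have hd : (diagonal fun x => (b' (τ x) : ℂ)) = tpow (diagonal fun i => (b i : ℂ)) k := by
    rw [tpow_diagonal]
    simp only [← hb']
    push_cast
    rfl
  rw [hd] at hle
  refine le_trans (le_of_eq ?_) (hle.trans ((h.tensor_pow k).klFin_le hM hN hE hE1))
  congr 1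
  have h1 : ∀ x : Fin k → γ, (tpow S k x x).re = ∏ i, (S (x i) (x i)).re := by
    intro x
    have : tpow S k x x = ((∏ i, (S (x i) (x i)).re : ℝ) : ℂ) := by
      push_cast
      change ∏ i, S (x i) (x i) = _
      exact Finset.prod_congr rfl fun i _ => hSg (x i)
    rw [this, Complex.ofReal_re]
  have h2 : ∑ g, (S g g).re = 1 := by
    rw [← Complex.re_sum]
    exact congrArg Complex.re hS.2
  simp only [h1, ← hb']
  rw [sum_prod_mul_log k ha1 fun g h => h, sum_prod_mul_log k h2 fun g h => by rw [hsupp g h]; rfl,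
    Fintype.card_fun, Fintype.card_fin]
  push_cast
  rw [Real.log_pow]
  ring

/-- The relative entropy of a pair of reachable states is at most the rate of growth of the measured
relative entropy of the channels. -/
lemma Reachable.relEntropy_le (hM : IsChannel M) (hN : IsChannel N) {l : ℕ} {γ : Type*} [Fintype γ]
    [DecidableEq γ] {σ ρ : Matrix γ γ ℂ} (h : Reachable M N l σ ρ) {c : ℝ≥0∞}
    (hc : ∀ k : ℕ, 1 ≤ k →
      measuredChannelRelEntropy (tensorPower M (k * l)) (tensorPower N (k * l)) ≤ k * c) :
    relEntropy σ ρ ≤ c := by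
  obtain ⟨hσ, hρ⟩ := h.isState hM hN
  obtain ⟨U, a, hU, hU', ha, hσe, hσl⟩ := exists_spectral_decomposition hσ.1
  obtain ⟨V, b, hV, hV', hb, hρe, hρl⟩ := exists_spectral_decomposition hρ.1
  -- Rotation into the eigenbasis of `ρ`, so that the second state becomes diagonal.
  have hR : Reachable M N l (Vᴴ * σ * V) (diagonal fun i => (b i : ℂ)) := by
    have := h.conj (V := Vᴴ) (by rw [conjTranspose_conjTranspose, hV'])
    rw [conjTranspose_conjTranspose] at this
    convert this using 1
    rw [hρe]
    simp only [mul_assoc, hV, mul_one]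
    rw [← mul_assoc, hV, one_mul]
  have hS := (hR.isState hM hN).1
  by_cases hg : ∀ g, b g = 0 → (Vᴴ * σ * V) g g = 0
  · have hle := hR.ofReal_le hM hN (U := Vᴴ * U) (a := a)
      (by rw [conjTranspose_mul, conjTranspose_conjTranspose, mul_assoc, ← mul_assoc V, hV',
            one_mul, hU])
      (by rw [conjTranspose_mul, conjTranspose_conjTranspose, mul_assoc, ← mul_assoc U, hU',
            one_mul, hV]) ha
      (by rw [hσe]; simp only [conjTranspose_mul, conjTranspose_conjTranspose, mul_assoc]) hg
    set s := ∑ i, a i * Real.log (a i) - ∑ g, ((Vᴴ * σ * V) g g).re * Real.log (b g) with hs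
    have hrel : relEntropy σ ρ = ENNReal.ofReal s := by
      unfold relEntropy
      rw [if_pos, hσl, hρl, Matrix.mul_sub, trace_sub, trace_mul_conj_diagonal,
        trace_mul_conj_diagonal, hs, Complex.sub_re, Complex.re_sum, Complex.re_sum]
      · congr 2
        · refine Finset.sum_congr rfl fun i _ => ?_
          have : Uᴴ * σ * U = diagonal fun i => (a i : ℂ) := by
            rw [hσe]
            simp only [mul_assoc, hU, mul_one]
            rw [← mul_assoc, hU, one_mul]
          rw [this, diagonal_apply_eq, ← Complex.ofReal_mul, Complex.ofReal_re, mul_comm]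
        · refine Finset.sum_congr rfl fun i _ => ?_
          rw [Complex.re_ofReal_mul, mul_comm]
      · intro v hv
        have h1 : (diagonal fun i => (b i : ℂ)) *ᵥ (Vᴴ *ᵥ v) = 0 := by
          have := congrArg (fun z => Vᴴ *ᵥ z) hv
          simp only [mulVec_zero] at this
          rwa [hρe, mulVec_mulVec, ← mul_assoc, ← mul_assoc, hV, one_mul, ← mulVec_mulVec] at this
        have h2 : (Vᴴ * σ * V) *ᵥ (Vᴴ *ᵥ v) = 0 := by
          rw [mulVec_eq_sum]
          refine Finset.sum_eq_zero fun g _ => ?_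
          have h3 := congrFun h1 g
          rw [mulVec_diagonal] at h3
          rcases mul_eq_zero.1 h3 with h4 | h4
          · have h5 := (hS.1.dotProduct_mulVec_zero_iff (Pi.single g 1)).1 (by
              simpa using hg g (Complex.ofReal_eq_zero.1 h4))
            rw [mulVec_single_one] at h5
            have h6 : (Vᴴ * σ * V)ᵀ g = 0 := h5
            rw [h6, smul_zero]
          · simp [h4]
        have h6 := congrArg (fun z => V *ᵥ z) h2
        simp only [mulVec_zero] at h6
        rw [mulVec_mulVec, mulVec_mulVec] at h6
        rwa [show V * (Vᴴ * σ * V) * Vᴴ = σ by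
          simp only [mul_assoc, hV', mul_one]
          rw [← mul_assoc, hV', one_mul]] at h6
    rw [hrel]
    by_cases hctop : c = ∞
    · rw [hctop]; exact le_top
    rw [← ENNReal.ofReal_toReal hctop]
    refine ENNReal.ofReal_le_ofReal ?_
    -- After division by `k` the pinching loss is of order `log (k + 1) / k` and disappears.
    have hlim : Tendsto (fun k : ℕ => c.toReal + Fintype.card γ * (Real.log (k + 1) / k)) atTop
        (𝓝 c.toReal) := by
      have h1 : Tendsto (fun k : ℕ => Real.log (k + 1) / k) atTop (𝓝 0) := by
        have h2 : Tendsto (fun x : ℝ => Real.log x / (1 * x + (-1))) atTop (𝓝 0) := by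
          simpa using Real.tendsto_pow_log_div_mul_add_atTop 1 (-1) 1 one_ne_zero
        have h3 := h2.comp (tendsto_atTop_add_const_right atTop (1 : ℝ)
          (tendsto_natCast_atTop_atTop (R := ℝ)))
        refine h3.congr fun k => ?_
        simp
      simpa using (h1.const_mul (Fintype.card γ : ℝ)).const_add c.toReal
    refine ge_of_tendsto hlim ?_
    filter_upwards [eventually_ge_atTop 1] with k hk
    have hk0 : (0 : ℝ) < k := by exact_mod_cast hk
    have h1 := (hle k).trans (hc k hk)
    rw [← ENNReal.ofReal_toReal hctop, ← ENNReal.ofReal_natCast, ← ENNReal.ofReal_mul hk0.le] at h1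
    have h2 := (ENNReal.ofReal_le_ofReal_iff (by positivity)).1 h1
    have h3 : s ≤ (k * c.toReal + Fintype.card γ * Real.log (k + 1)) / k := by
      rw [le_div_iff₀ hk0]
      linarith
    refine h3.trans_eq ?_
    field_simp
  · push Not at hg
    obtain ⟨g, hbg, hSg⟩ := hg
    -- If the supports are not nested, the measurement in the eigenbasis of `ρ` already has infinite
    -- relative entropy, and the hypothesis at `k = 1` forces `c = ∞`.
    have h1 := hR.klFin_le hM hN (E := fun i : γ => single i i (1 : ℂ)) (fun i => by
      have := posSemidef_vecMulVec_self_star (Pi.single i (1 : ℂ) : γ → ℂ)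
      simpa [Pi.star_single, ← single_eq_single_vecMulVec_single] using this) (by
      ext x y
      rw [Matrix.sum_apply]
      simp [single_apply, one_apply, ite_and])
    have h2 : ∀ X : Matrix γ γ ℂ, ∀ i, (single i i (1 : ℂ) * X).trace = X i i := by
      intro X i
      rw [trace_single_mul, one_smul]
    simp only [h2] at h1
    unfold klFin at h1
    rw [if_neg] at h1
    · have h3 := hc 1 le_rfl
      rw [one_mul, Nat.cast_one, one_mul] at h3
      exact le_top.trans (h1.trans h3)
    · push Not
      refine ⟨g, by simp [hbg], fun h0 => hSg ?_⟩
      have := (Complex.nonneg_iff.1 (hS.1.diag_nonneg (i := g))).2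
      exact Complex.ext h0 this.symm

end Regularization

end ChangePoint

namespace ChangePoint

open Matrix Kronecker

/-! ### Superadditivity and the regularized relative entropy -/

lemma sum_mul_log_div_nonneg {ι : Type*} [Fintype ι] {q p : ι → ℝ} (hq0 : ∀ x, 0 ≤ q x)
    (hp0 : ∀ x, 0 ≤ p x) (hpq : ∑ x, p x ≤ ∑ x, q x) (hac : ∀ x, p x = 0 → q x = 0) :
    0 ≤ ∑ x, q x * Real.log (q x / p x) := by
  have : ∀ x, q x - p x ≤ q x * Real.log (q x / p x) := by
    intro x
    rcases (hq0 x).eq_or_lt with hx | hx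
    · simpa [← hx] using hp0 x
    · have hpx : 0 < p x := (hp0 x).lt_of_ne' fun h => hx.ne' (hac x h)
      have h1 := Real.log_le_sub_one_of_pos (div_pos hpx hx)
      rw [← inv_div, Real.log_inv] at h1
      have h2 := mul_le_mul_of_nonneg_left h1 hx.le
      rw [mul_sub, inv_div, mul_div_cancel₀ _ hx.ne'] at h2
      linarith
  have h := Finset.sum_le_sum fun x (_ : x ∈ Finset.univ) => this x
  rw [Finset.sum_sub_distrib] at h
  linarith

lemma klFin_add_le {ι κ : Type*} [Fintype ι] [Fintype κ] {q₁ p₁ : ι → ℝ} {q₂ p₂ : κ → ℝ}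
    (hq₁ : ∀ x, 0 ≤ q₁ x) (hp₁ : ∀ x, 0 ≤ p₁ x) (hq₂ : ∀ x, 0 ≤ q₂ x) (hp₂ : ∀ x, 0 ≤ p₂ x)
    (hq₁1 : ∑ x, q₁ x = 1) (hp₁1 : ∑ x, p₁ x = 1) (hq₂1 : ∑ x, q₂ x = 1) (hp₂1 : ∑ x, p₂ x = 1) :
    klFin q₁ p₁ + klFin q₂ p₂ ≤
      klFin (fun z : ι × κ => q₁ z.1 * q₂ z.2) (fun z : ι × κ => p₁ z.1 * p₂ z.2) := by
  by_cases hac : ∀ z : ι × κ, p₁ z.1 * p₂ z.2 = 0 → q₁ z.1 * q₂ z.2 = 0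
  swap
  · rw [klFin.eq_def (fun z : ι × κ => q₁ z.1 * q₂ z.2), if_neg hac]
    exact le_top
  have h1 : ∀ x, p₁ x = 0 → q₁ x = 0 := by
    intro x hx
    obtain ⟨y, -, hy⟩ := Finset.exists_ne_zero_of_sum_ne_zero (hq₂1.trans_ne one_ne_zero)
    exact (mul_eq_zero.1 (hac (x, y) (by simp [hx]))).resolve_right hy
  have h2 : ∀ y, p₂ y = 0 → q₂ y = 0 := by
    intro y hy
    obtain ⟨x, -, hx⟩ := Finset.exists_ne_zero_of_sum_ne_zero (hq₁1.trans_ne one_ne_zero)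
    exact (mul_eq_zero.1 (hac (x, y) (by simp [hy]))).resolve_left hx
  rw [klFin, klFin, klFin, if_pos h1, if_pos h2, if_pos hac, ← ENNReal.ofReal_add
    (sum_mul_log_div_nonneg hq₁ hp₁ (hp₁1.trans hq₁1.symm).le h1)
    (sum_mul_log_div_nonneg hq₂ hp₂ (hp₂1.trans hq₂1.symm).le h2)]
  refine le_of_eq ?_
  congr 1
  have h3 : ∀ x y, q₁ x * q₂ y * Real.log (q₁ x * q₂ y / (p₁ x * p₂ y)) =
      q₁ x * Real.log (q₁ x / p₁ x) * q₂ y + q₁ x * (q₂ y * Real.log (q₂ y / p₂ y)) := by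
    intro x y
    by_cases hx : q₁ x = 0
    · simp [hx]
    by_cases hy : q₂ y = 0
    · simp [hy]
    rw [mul_div_mul_comm, Real.log_mul (div_ne_zero hx fun h => hx (h1 x h))
      (div_ne_zero hy fun h => hy (h2 y h))]
    ring
  rw [Fintype.sum_prod_type]
  simp only [h3, Finset.sum_add_distrib, ← Finset.mul_sum, ← Finset.sum_mul, hq₂1, hq₁1, mul_one,
    one_mul]

section

variable {α β : Type*} [Fintype α] [DecidableEq α] [Fintype β] [DecidableEq β]
  {M N : Matrix α α ℂ →ₗ[ℂ] Matrix β β ℂ}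

lemma exists_isState (α : Type*) [Fintype α] [DecidableEq α] [Nonempty α] :
    ∃ ω : Matrix α α ℂ, IsState ω := by
  obtain ⟨x⟩ := ‹Nonempty α›
  refine ⟨single x x 1, ?_, by simp⟩
  have := posSemidef_vecMulVec_self_star (Pi.single x (1 : ℂ) : α → ℂ)
  simpa [Pi.star_single, ← single_eq_single_vecMulVec_single] using this

/-- The measurement with one outcome. -/
def trivialPOVM (γ : Type*) [Fintype γ] [DecidableEq γ] : POVM γ 1 where
  effect := fun _ => 1
  posSemidef := fun _ => PosSemidef.one
  sum_eq_one := by simp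

/-- The relative entropies of the outcomes of all ways of measuring `l` uses. -/
def experimentValues (M N : Matrix α α ℂ →ₗ[ℂ] Matrix β β ℂ) (l : ℕ) : Set ℝ≥0∞ :=
  {v | ∃ (r : ℕ) (ω : Matrix ((Fin l → α) × Fin r) ((Fin l → α) × Fin r) ℂ) (m : ℕ)
    (E : POVM ((Fin l → β) × Fin r) m), IsState ω ∧
    v = klFin (fun x => (E.effect x * ampliate (Fin r) (tensorPower M l) ω).trace.re)
      (fun x => (E.effect x * ampliate (Fin r) (tensorPower N l) ω).trace.re)}

lemma measuredChannelRelEntropy_eq_sSup (hM : IsChannel M) (hN : IsChannel N) (l : ℕ) :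
    measuredChannelRelEntropy (tensorPower M l) (tensorPower N l) =
      sSup (experimentValues M N l) := by
  apply le_antisymm
  · refine iSup_le fun r => iSup_le fun ω => iSup_le fun hω => iSup_le fun m => iSup_le fun E => ?_
    obtain ⟨h1, h2⟩ := (reachable_output (M := M) (N := N) hω).isState hM hN
    rw [measuredRelEntropy_eq E h1 h2]
    exact le_sSup ⟨r, ω, m, E, hω, rfl⟩
  · refine sSup_le ?_
    rintro v ⟨r, ω, m, E, hω, rfl⟩
    exact (reachable_output hω).klFin_le hM hN E.posSemidef E.sum_eq_one

/-- Two experiments can be run side by side. Their outcomes are independent under both channels, so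
the relative entropies of the outcomes add. -/
lemma measuredChannelRelEntropy_add_le [Nonempty α] (hM : IsChannel M) (hN : IsChannel N)
    (l₁ l₂ : ℕ) :
    measuredChannelRelEntropy (tensorPower M l₁) (tensorPower N l₁) +
        measuredChannelRelEntropy (tensorPower M l₂) (tensorPower N l₂) ≤
      measuredChannelRelEntropy (tensorPower M (l₁ + l₂)) (tensorPower N (l₁ + l₂)) := by
  -- Splitting a sum of suprema needs nonempty index sets; an input state exists because `α` is
  -- nonempty.
  have hne : ∀ l, Nonempty (experimentValues M N l) := fun l => by
    obtain ⟨ω, hω⟩ := exists_isState ((Fin l → α) × Fin 1)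
    exact ⟨_, 1, ω, 1, trivialPOVM _, hω, rfl⟩
  rw [measuredChannelRelEntropy_eq_sSup hM hN l₁, measuredChannelRelEntropy_eq_sSup hM hN l₂,
    sSup_eq_iSup', sSup_eq_iSup']
  refine ENNReal.iSup_add_iSup_le ?_
  rintro ⟨v₁, r₁, ω₁, m₁, E₁, hω₁, rfl⟩ ⟨v₂, r₂, ω₂, m₂, E₂, hω₂, rfl⟩
  have h1 := reachable_output (M := M) (N := N) hω₁
  have h2 := reachable_output (M := M) (N := N) hω₂
  obtain ⟨hs1, ht1⟩ := h1.isState hM hN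
  obtain ⟨hs2, ht2⟩ := h2.isState hM hN
  have hsum : ∀ {γ : Type _} [Fintype γ] [DecidableEq γ] {m : ℕ} (E : POVM γ m)
      {τ : Matrix γ γ ℂ}, IsState τ → ∑ x, (E.effect x * τ).trace.re = 1 := by
    intro γ _ _ m E τ hτ
    rw [← Complex.re_sum, ← trace_sum, ← Finset.sum_mul, E.sum_eq_one, one_mul, hτ.2,
      Complex.one_re]
  refine (klFin_add_le (fun x => trace_mul_nonneg (E₁.posSemidef x) hs1.1)
    (fun x => trace_mul_nonneg (E₁.posSemidef x) ht1.1)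
    (fun x => trace_mul_nonneg (E₂.posSemidef x) hs2.1)
    (fun x => trace_mul_nonneg (E₂.posSemidef x) ht2.1) (hsum E₁ hs1) (hsum E₁ ht1) (hsum E₂ hs2)
    (hsum E₂ ht2)).trans ?_
  -- The trace of a product of two positive operators is real, so the real part of a product of such
  -- traces is the product of the real parts.
  have him : ∀ {γ : Type _} [Fintype γ] [DecidableEq γ] {A B : Matrix γ γ ℂ}, A.PosSemidef →
      B.PosSemidef → (A * B).trace.im = 0 := by
    intro γ _ _ A B hA hB
    obtain ⟨U, b, -, -, hb, rfl, -⟩ := exists_spectral_decomposition hB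
    rw [trace_mul_conj_diagonal, Complex.im_sum]
    refine Finset.sum_eq_zero fun i _ => ?_
    rw [Complex.im_ofReal_mul, ← (Complex.nonneg_iff.1
      (hA.conjTranspose_mul_mul_same U).diag_nonneg).2, mul_zero]
  have hle := (h1.kronecker h2).klFin_le hM hN
    (E := fun z : Fin m₁ × Fin m₂ => E₁.effect z.1 ⊗ₖ E₂.effect z.2)
    (fun z => (E₁.posSemidef _).kronecker (E₂.posSemidef _))
    (by
      have h3 : ∀ x y, ∑ k, E₁.effect k x y = (1 : Matrix _ _ ℂ) x y := fun x y => by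
        rw [← E₁.sum_eq_one, Matrix.sum_apply]
      have h4 : ∀ x y, ∑ k, E₂.effect k x y = (1 : Matrix _ _ ℂ) x y := fun x y => by
        rw [← E₂.sum_eq_one, Matrix.sum_apply]
      ext x y
      rw [Matrix.sum_apply, Fintype.sum_prod_type, ← one_kronecker_one]
      simp only [kroneckerMap_apply, ← Finset.mul_sum, ← Finset.sum_mul, h3, h4])
  refine le_trans (le_of_eq ?_) hle
  congr 1
  · ext z
    rw [← mul_kronecker_mul, trace_kronecker, Complex.mul_re,
      him (E₁.posSemidef _) hs1.1, zero_mul, sub_zero]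
  · ext z
    rw [← mul_kronecker_mul, trace_kronecker, Complex.mul_re,
      him (E₁.posSemidef _) ht1.1, zero_mul, sub_zero]

/-- Fekete's lemma for superadditive sequences in `[0, ∞]`. -/
lemma tendsto_div_of_superadditive {g : ℕ → ℝ≥0∞} (hg : ∀ m n, g m + g n ≤ g (m + n)) :
    Tendsto (fun l : ℕ => g l / (l : ℝ≥0∞)) atTop
      (𝓝 (⨆ (n : ℕ) (_ : 1 ≤ n), g n / (n : ℝ≥0∞))) := by
  have hmul : ∀ k n : ℕ, (k : ℝ≥0∞) * g n ≤ g (k * n) := by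
    intro k n
    induction k with
    | zero => simp
    | succ k ih =>
      rw [Nat.succ_mul]
      refine le_trans ?_ (hg _ _)
      push_cast
      rw [add_mul, one_mul]
      gcongr
  have hmono : Monotone g := by
    refine monotone_nat_of_le_succ fun n => le_trans ?_ (hg n 1)
    exact le_self_add
  refine tendsto_of_le_liminf_of_limsup_le ?_ ?_
  · refine iSup₂_le fun n hn => ?_
    -- `l` uses contain `⌊l / n⌋` blocks of length `n`, and the leftover uses cost nothing because
    -- `g` is monotone.
    have hlim : Tendsto (fun l : ℕ => ((l / n : ℕ) : ℝ≥0∞) / l * g n) atTop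
        (𝓝 ((n : ℝ≥0∞)⁻¹ * g n)) := by
      refine ENNReal.Tendsto.mul_const ?_ (Or.inl (by simp))
      have h1 : Tendsto (fun l : ℕ => ((⌊(l : ℝ) / n⌋₊ : ℕ) : ℝ) / l) atTop (𝓝 ((n : ℝ)⁻¹)) := by
        have h2 := (tendsto_nat_floor_mul_div_atTop (R := ℝ) (a := (n : ℝ)⁻¹) (by positivity)).comp
          tendsto_natCast_atTop_atTop
        refine h2.congr fun l => ?_
        simp [div_eq_mul_inv, mul_comm]
      have h3 := ENNReal.tendsto_ofReal h1
      have hn0 : (0 : ℝ) < n := by exact_mod_cast hn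
      rw [ENNReal.ofReal_inv_of_pos hn0, ENNReal.ofReal_natCast] at h3
      refine h3.congr' ?_
      filter_upwards [eventually_ge_atTop 1] with l hl
      have hl0 : (0 : ℝ) < l := by exact_mod_cast hl
      rw [ENNReal.ofReal_div_of_pos hl0, ENNReal.ofReal_natCast, ENNReal.ofReal_natCast,
        Nat.floor_div_eq_div]
    rw [div_eq_mul_inv, mul_comm, ← hlim.liminf_eq]
    refine liminf_le_liminf (Eventually.of_forall fun l => ?_)
    rw [div_eq_mul_inv, mul_right_comm, ← div_eq_mul_inv]
    exact ENNReal.div_le_div_right ((hmul _ _).trans (hmono (Nat.div_mul_le_self l n))) _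
  · refine limsup_le_of_le (by isBoundedDefault) ?_
    filter_upwards [eventually_ge_atTop 1] with l hl
    exact le_iSup₂_of_le l hl le_rfl

lemma mul_iSup_div_ge {g : ℕ → ℝ≥0∞} {n : ℕ} (hn : 1 ≤ n) :
    g n ≤ n * ⨆ (n : ℕ) (_ : 1 ≤ n), g n / (n : ℝ≥0∞) := by
  have h1 : g n / (n : ℝ≥0∞) ≤ ⨆ (n : ℕ) (_ : 1 ≤ n), g n / (n : ℝ≥0∞) :=
    le_iSup₂_of_le n hn le_rfl
  rw [mul_comm]
  exact (ENNReal.div_le_iff (by simp; omega) (by simp)).1 h1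

/-- Both rates converge, to the rate of growth of the measured relative entropy. -/
lemma tendsto_channelRelEntropy [Nonempty α] (hM : IsChannel M) (hN : IsChannel N) :
    Tendsto (fun l : ℕ => channelRelEntropy (tensorPower M l) (tensorPower N l) / (l : ℝ≥0∞)) atTop
      (𝓝 (⨆ (n : ℕ) (_ : 1 ≤ n),
        measuredChannelRelEntropy (tensorPower M n) (tensorPower N n) / (n : ℝ≥0∞))) := by
  refine tendsto_of_tendsto_of_tendsto_of_le_of_le'
    (tendsto_div_of_superadditive (measuredChannelRelEntropy_add_le hM hN)) tendsto_const_nhds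
    (Eventually.of_forall fun l =>
      ENNReal.div_le_div_right (measuredChannelRelEntropy_le hM hN l) _) ?_
  filter_upwards [eventually_ge_atTop 1] with l hl
  refine ENNReal.div_le_of_le_mul' ?_
  refine iSup_le fun r => iSup_le fun ω => iSup_le fun hω => ?_
  refine (reachable_output hω).relEntropy_le hM hN fun k hk => ?_
  have := mul_iSup_div_ge (g := fun n => measuredChannelRelEntropy (tensorPower M n)
    (tensorPower N n)) (n := k * l) (Nat.mul_pos hk hl)
  rwa [Nat.cast_mul, mul_assoc] at this

lemma regularizedRelEntropy_eq [Nonempty α] (hM : IsChannel M) (hN : IsChannel N) :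
    regularizedRelEntropy M N = ⨆ (n : ℕ) (_ : 1 ≤ n),
      measuredChannelRelEntropy (tensorPower M n) (tensorPower N n) / (n : ℝ≥0∞) :=
  (tendsto_channelRelEntropy hM hN).limsup_eq

end

end ChangePoint

namespace ChangePoint

open ProbabilityTheory

/-! ### Independent sequences with values in a finite set -/

section Sequences

variable {m : ℕ}

/-- A function of the first `k` outcomes factors through a finite set. Measurability is then
automatic, and independence from later outcomes comes from that of the coordinates. -/
lemma exists_comp_restrict {E : Type*} [Nonempty E] {k : ℕ} {f : (ℕ → Fin m) → E}
    (hf : DependsOn f (Set.Iio k)) :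
    ∃ F : (Finset.range k → Fin m) → E, ∀ ω, f ω = F fun i => ω i := by
  rcases isEmpty_or_nonempty (ℕ → Fin m) with h | ⟨⟨ω₀⟩⟩
  · exact ⟨fun _ => Classical.arbitrary E, fun ω => (h.false ω).elim⟩
  · refine ⟨fun u => f fun i => if hi : i ∈ Finset.range k then u ⟨i, hi⟩ else ω₀ i, fun ω => ?_⟩
    refine hf fun i hi => ?_
    simp [Set.mem_Iio.1 hi]

lemma measurable_of_dependsOn {E : Type*} [MeasurableSpace E] [Nonempty E] {k : ℕ}
    {f : (ℕ → Fin m) → E} (hf : DependsOn f (Set.Iio k)) : Measurable f := by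
  obtain ⟨F, hF⟩ := exists_comp_restrict hf
  rw [funext hF]
  exact (measurable_of_finite F).comp (by fun_prop)

lemma dependsOn_indicator {E : Type*} [Zero E] {s : Set ℕ} {A : Set (ℕ → Fin m)}
    {f : (ℕ → Fin m) → E} (hA : DependsOn (fun ω => ω ∈ A) s) (hf : DependsOn f s) :
    DependsOn (A.indicator f) s := by
  intro ω ω' h
  have h1 : (ω ∈ A) = (ω' ∈ A) := hA h
  by_cases h2 : ω' ∈ A
  · rw [Set.indicator_of_mem h2, Set.indicator_of_mem (h1 ▸ h2), hf h]
  · rw [Set.indicator_of_notMem h2, Set.indicator_of_notMem (h1 ▸ h2)]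

lemma indepFun_of_dependsOn (μ : ℕ → Measure (Fin m)) [∀ k, IsProbabilityMeasure (μ k)]
    {E : Type*} [MeasurableSpace E] [Nonempty E] {k : ℕ}
    {f : (ℕ → Fin m) → E} (hf : DependsOn f (Set.Iio k)) :
    IndepFun f (fun ω => ω k) (Measure.infinitePi μ) := by
  obtain ⟨F, hF⟩ := exists_comp_restrict hf
  have h1 : iIndepFun (fun i (ω : ℕ → Fin m) => ω i) (Measure.infinitePi μ) :=
    iIndepFun_infinitePi (X := fun _ x => x) fun _ => measurable_id
  have h2 := h1.indepFun_finset (Finset.range k) {k} (by simp) fun i => measurable_pi_apply i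
  rw [funext hF]
  exact h2.comp (measurable_of_finite F)
    (measurable_pi_apply (⟨k, by simp⟩ : ({k} : Finset ℕ)))

lemma lintegral_mul_of_dependsOn (μ : ℕ → Measure (Fin m)) [∀ k, IsProbabilityMeasure (μ k)]
    {k : ℕ} {f : (ℕ → Fin m) → ℝ≥0∞} (hf : DependsOn f (Set.Iio k)) (g : Fin m → ℝ≥0∞) :
    ∫⁻ ω, f ω * g (ω k) ∂(Measure.infinitePi μ) =
      (∫⁻ ω, f ω ∂(Measure.infinitePi μ)) * ∫⁻ x, g x ∂(μ k) := by
  have h1 : IndepFun f (fun ω => g (ω k)) (Measure.infinitePi μ) :=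
    (indepFun_of_dependsOn μ hf).comp measurable_id (measurable_of_finite g)
  have hgm : Measurable fun ω : ℕ → Fin m => g (ω k) :=
    (measurable_of_finite g).comp (measurable_pi_apply k)
  rw [lintegral_mul_eq_lintegral_mul_lintegral_of_indepFun''
    (measurable_of_dependsOn hf).aemeasurable hgm.aemeasurable h1,
    ← (measurePreserving_eval_infinitePi μ k).lintegral_comp (measurable_of_finite g)]

lemma integral_indicator_mul_of_dependsOn (μ : ℕ → Measure (Fin m))
    [∀ k, IsProbabilityMeasure (μ k)] {k : ℕ} {A : Set (ℕ → Fin m)}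
    (hA : DependsOn (fun ω => ω ∈ A) (Set.Iio k)) (g : Fin m → ℝ) :
    ∫ ω, A.indicator (fun _ => (1 : ℝ)) ω * g (ω k) ∂(Measure.infinitePi μ) =
      (Measure.infinitePi μ).real A * ∫ x, g x ∂(μ k) := by
  have hf : DependsOn (A.indicator fun _ => (1 : ℝ)) (Set.Iio k) :=
    dependsOn_indicator hA fun _ _ _ => rfl
  have hAm : MeasurableSet A := measurableSet_setOfPred.2 (measurable_of_dependsOn hA)
  have h1 : IndepFun (A.indicator fun _ => (1 : ℝ)) (fun ω => g (ω k)) (Measure.infinitePi μ) :=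
    (indepFun_of_dependsOn μ hf).comp measurable_id (measurable_of_finite g)
  rw [h1.integral_fun_mul_eq_mul_integral (measurable_of_dependsOn hf).aestronglyMeasurable
    ((measurable_of_finite g).comp (measurable_pi_apply k)).aestronglyMeasurable,
    integral_indicator_const _ hAm, smul_eq_mul, mul_one]
  congr 1
  rw [← (measurePreserving_eval_infinitePi μ k).map_eq]
  exact (integral_map (measurable_pi_apply k).aemeasurable
    (measurable_of_finite g).aestronglyMeasurable).symm

/-- The Shiryaev–Roberts statistic. -/
noncomputable def shiryaevRoberts (L : Fin m → ℝ≥0∞) : ℕ → (ℕ → Fin m) → ℝ≥0∞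
  | 0, _ => 0
  | n + 1, ω => (shiryaevRoberts L n ω + 1) * L (ω n)

lemma dependsOn_shiryaevRoberts (L : Fin m → ℝ≥0∞) (n : ℕ) :
    DependsOn (shiryaevRoberts L n) (Set.Iio n) := by
  induction n with
  | zero => intro ω ω' _; rfl
  | succ n ih =>
    intro ω ω' h
    simp only [shiryaevRoberts]
    rw [ih fun i hi => h i (Set.mem_Iio.2 ((Set.mem_Iio.1 hi).trans n.lt_succ_self)),
      h n (Set.mem_Iio.2 n.lt_succ_self)]

/-- Unfolding the recursion, the statistic is the sum over all starting points `j < n` of these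
products, so it dominates each of them. -/
lemma prod_le_shiryaevRoberts (L : Fin m → ℝ≥0∞) {j n : ℕ} (hj : j < n) (ω : ℕ → Fin m) :
    ∏ i ∈ Finset.Ico j n, L (ω i) ≤ shiryaevRoberts L n ω := by
  induction n with
  | zero => omega
  | succ n ih =>
    rw [Finset.prod_Ico_succ_top (Nat.lt_succ_iff.1 hj), shiryaevRoberts]
    gcongr
    rcases (Nat.lt_succ_iff.1 hj).eq_or_lt with h | h
    · simp [h]
    · exact (ih h).trans le_self_add

/-- The mean time of the first entry of the Shiryaev–Roberts statistic into `[t, ∞]` is at least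
`t`. -/
lemma le_tsum_of_shiryaevRoberts (μ : ℕ → Measure (Fin m)) [∀ k, IsProbabilityMeasure (μ k)]
    {L : Fin m → ℝ≥0∞} (hL : ∀ k, ∫⁻ x, L x ∂(μ k) ≤ 1) {t : ℝ≥0∞} (ht : t ≠ ∞)
    {A : ℕ → Set (ℕ → Fin m)} (hA : ∀ n, DependsOn (fun ω => ω ∈ A n) (Set.Iio n))
    (hA0 : A 0 = Set.univ) (hanti : Antitone A)
    (hAt : ∀ n, ∀ ω ∈ A n, ω ∉ A (n + 1) → t ≤ shiryaevRoberts L (n + 1) ω) :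
    t ≤ ∑' n, Measure.infinitePi μ (A n) := by
  set P := Measure.infinitePi μ
  set R := shiryaevRoberts L
  have hAm : ∀ n, MeasurableSet (A n) := fun n =>
    measurableSet_setOfPred.2 (measurable_of_dependsOn (hA n))
  have hRm : ∀ n, Measurable (R n) := fun n =>
    measurable_of_dependsOn (dependsOn_shiryaevRoberts L n)
  -- The next factor is independent of the past and has mean at most `1`, so on the event of not
  -- having stopped the mean grows by at most the probability of that event.
  have hstep : ∀ n, ∫⁻ ω in A n, R (n + 1) ω ∂P ≤ ∫⁻ ω in A n, R n ω ∂P + P (A n) := by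
    intro n
    have hd : DependsOn ((A n).indicator fun ω => R n ω + 1) (Set.Iio n) :=
      dependsOn_indicator (hA n) fun ω ω' h => by
        simp only [R]
        rw [dependsOn_shiryaevRoberts L n h]
    calc ∫⁻ ω in A n, R (n + 1) ω ∂P
        = ∫⁻ ω, (A n).indicator (fun ω => R n ω + 1) ω * L (ω n) ∂P := by
          rw [← lintegral_indicator (hAm n)]
          refine lintegral_congr fun ω => ?_
          by_cases h : ω ∈ A n <;> simp [h, R, shiryaevRoberts]
      _ = (∫⁻ ω, (A n).indicator (fun ω => R n ω + 1) ω ∂P) * ∫⁻ x, L x ∂(μ n) :=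
          lintegral_mul_of_dependsOn μ hd L
      _ ≤ (∫⁻ ω, (A n).indicator (fun ω => R n ω + 1) ω ∂P) * 1 := by gcongr; exact hL n
      _ = ∫⁻ ω in A n, R n ω ∂P + P (A n) := by
          rw [mul_one, lintegral_indicator (hAm n), lintegral_add_right _ measurable_const,
            lintegral_one, Measure.restrict_apply_univ]
  have hsplit : ∀ n, ∫⁻ ω in A (n + 1), R (n + 1) ω ∂P + t * P (A n \ A (n + 1)) ≤
      ∫⁻ ω in A n, R (n + 1) ω ∂P := by
    intro n
    have h1 : A n = A (n + 1) ∪ (A n \ A (n + 1)) :=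
      (Set.union_sdiff_cancel (hanti n.le_succ)).symm
    conv_rhs => rw [h1, lintegral_union ((hAm n).diff (hAm (n + 1))) Set.disjoint_sdiff_right]
    gcongr
    rw [← setLIntegral_const]
    exact setLIntegral_mono' ((hAm n).diff (hAm (n + 1))) fun ω hω => hAt n ω hω.1 hω.2
  -- A form of optional stopping: the mass that has stopped contributes at least `t` per unit, and
  -- the total growth is the truncated mean of the stopping time.
  have hsum : ∀ n, ∫⁻ ω in A n, R n ω ∂P + t * P ((A n)ᶜ) ≤ ∑ k ∈ Finset.range n, P (A k) := by
    intro n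
    induction n with
    | zero => simp [hA0, R, shiryaevRoberts]
    | succ n ih =>
      rw [Finset.sum_range_succ]
      have h1 : P ((A (n + 1))ᶜ) ≤ P (A n \ A (n + 1)) + P ((A n)ᶜ) := by
        refine (measure_mono fun ω hω => ?_).trans (measure_union_le _ _)
        by_cases h : ω ∈ A n
        · exact Or.inl ⟨h, hω⟩
        · exact Or.inr h
      calc ∫⁻ ω in A (n + 1), R (n + 1) ω ∂P + t * P ((A (n + 1))ᶜ)
          ≤ ∫⁻ ω in A (n + 1), R (n + 1) ω ∂P + t * (P (A n \ A (n + 1)) + P ((A n)ᶜ)) := by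
            gcongr
        _ = (∫⁻ ω in A (n + 1), R (n + 1) ω ∂P + t * P (A n \ A (n + 1))) + t * P ((A n)ᶜ) := by
            rw [mul_add, add_assoc]
        _ ≤ (∫⁻ ω in A n, R n ω ∂P + P (A n)) + t * P ((A n)ᶜ) := by
            exact add_le_add_left ((hsplit n).trans (hstep n)) _
        _ = (∫⁻ ω in A n, R n ω ∂P + t * P ((A n)ᶜ)) + P (A n) := by ring
        _ ≤ _ := by gcongr
  -- If the mean stopping time is finite, almost all the mass eventually stops, and `t P((A n)ᶜ)`
  -- tends to `t`.
  by_cases hs : ∑' n, P (A n) = ∞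
  · rw [hs]; exact le_top
  have h0 := ENNReal.tendsto_atTop_zero_of_tsum_ne_top hs
  have h1 : Tendsto (fun n => t * P ((A n)ᶜ)) atTop (𝓝 (t * 1)) := by
    refine ENNReal.Tendsto.const_mul ?_ (Or.inr ht)
    have h2 : ∀ n, P ((A n)ᶜ) = 1 - P (A n) := fun n => prob_compl_eq_one_sub (hAm n)
    simp only [h2]
    simpa using ENNReal.Tendsto.sub (tendsto_const_nhds (x := (1 : ℝ≥0∞))) h0
      (Or.inl ENNReal.one_ne_top)
  rw [mul_one] at h1
  exact le_of_tendsto h1 (Eventually.of_forall fun n =>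
    (le_add_self.trans (hsum n)).trans (ENNReal.sum_le_tsum _))

/-- A bound in the spirit of Wald's identity for the mean number of steps, on the event `B`. -/
lemma tsum_measure_le_of_drift (μ : ℕ → Measure (Fin m)) [∀ k, IsProbabilityMeasure (μ k)]
    {j : ℕ} {z : Fin m → ℝ} {D : ℝ} (hD : 0 < D) (hz : ∀ k, j ≤ k → ∫ x, z x ∂(μ k) = D)
    {B : Set (ℕ → Fin m)} (hB : MeasurableSet B) {G : ℕ → Set (ℕ → Fin m)}
    (hG : ∀ k, DependsOn (fun ω => ω ∈ G k) (Set.Iio (j + k))) {H : ℝ} (hH : 0 ≤ H)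
    (hle : ∀ n, ∀ᵐ ω ∂(Measure.infinitePi μ),
      ∑ k ∈ Finset.range n, (G k).indicator (fun _ => (1 : ℝ)) ω * z (ω (j + k)) ≤
        B.indicator (fun _ => H) ω) :
    ∑' k, Measure.infinitePi μ (G k) ≤ ENNReal.ofReal (H / D) * Measure.infinitePi μ B := by
  set P := Measure.infinitePi μ
  have hGm : ∀ n, MeasurableSet (G n) := fun n =>
    measurableSet_setOfPred.2 (measurable_of_dependsOn (hG n))
  have hint : ∀ k, Integrable
      (fun ω => (G k).indicator (fun _ => (1 : ℝ)) ω * z (ω (j + k))) P := by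
    intro k
    have h1 : Integrable (fun ω : ℕ → Fin m => z (ω (j + k))) P :=
      (measurePreserving_eval_infinitePi μ (j + k)).integrable_comp_of_integrable
        (Integrable.of_finite (f := z))
    refine (h1.indicator (hGm k)).congr (Eventually.of_forall fun ω => ?_)
    by_cases h : ω ∈ G k <;> simp [h]
  refine ENNReal.tsum_le_of_sum_range_le fun n => ?_
  have h1 := integral_mono_ae (integrable_finsetSum _ fun k _ => hint k)
    ((integrable_const H).indicator hB) (hle n)
  rw [integral_finsetSum _ fun k _ => hint k, integral_indicator_const _ hB] at h1
  -- Whether step `k` is taken depends only on outcomes before `j + k`, so the increment at that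
  -- step is independent of it and contributes its mean `D`.
  have h3 : ∀ k, ∫ ω, (G k).indicator (fun _ => (1 : ℝ)) ω * z (ω (j + k)) ∂P =
      P.real (G k) * D := fun k => by
    rw [integral_indicator_mul_of_dependsOn μ (hG k), hz _ (Nat.le_add_right j k)]
  simp only [h3, ← Finset.sum_mul, smul_eq_mul] at h1
  have h2 : ∑ k ∈ Finset.range n, P.real (G k) ≤ H / D * P.real B := by
    rw [div_mul_eq_mul_div, le_div_iff₀ hD]
    linarith
  calc ∑ k ∈ Finset.range n, P (G k) = ENNReal.ofReal (∑ k ∈ Finset.range n, P.real (G k)) := by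
        rw [ENNReal.ofReal_sum_of_nonneg fun k _ => measureReal_nonneg]
        exact Finset.sum_congr rfl fun k _ => (ofReal_measureReal).symm
    _ ≤ ENNReal.ofReal (H / D * P.real B) := ENNReal.ofReal_le_ofReal h2
    _ = _ := by rw [ENNReal.ofReal_mul (div_nonneg hH hD.le), ofReal_measureReal]

end Sequences

lemma toENNReal_eq_tsum (x : ℕ∞) : (x : ℝ≥0∞) = ∑' k : ℕ, if (k : ℕ∞) < x then 1 else 0 := by
  induction x using ENat.recTopCoe with
  | top => simp
  | coe n =>
    rw [tsum_eq_sum (s := Finset.range n)]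
    · rw [Finset.sum_congr rfl fun k hk => if_pos (Nat.cast_lt.2 (Finset.mem_range.1 hk))]
      simp
    · intro k hk
      rw [if_neg]
      simpa using hk

end ChangePoint

namespace ChangePoint

/-! ### QUSUM -/

/-- The tail-sum formula, with each of the first `j` terms bounded by one. -/
lemma toENNReal_le_add_tsum (x : ℕ∞) (j : ℕ) :
    (x : ℝ≥0∞) ≤ j + ∑' k : ℕ, if ((j + k : ℕ) : ℕ∞) < x then 1 else 0 := by
  rw [toENNReal_eq_tsum,
    ← (ENNReal.summable.sum_add_tsum_nat_add' (f := fun k : ℕ => if (k : ℕ∞) < x then 1 else 0)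
      (k := j))]
  refine add_le_add ?_ (ENNReal.tsum_le_tsum fun k => ?_)
  · refine (Finset.sum_le_sum (g := fun _ => (1 : ℝ≥0∞)) fun k _ => ?_).trans_eq (by simp)
    split_ifs <;> simp
  · rw [add_comm k j]

namespace BlockScheme

variable {α β : Type*} [Fintype α] [DecidableEq α] [Fintype β] [DecidableEq β]
  (S : BlockScheme α β) {N M : Matrix α α ℂ →ₗ[ℂ] Matrix β β ℂ}

/-- The probability of an outcome for `l` uses of the channel `Φ`, as a real number. -/
def prob (Φ : Matrix α α ℂ →ₗ[ℂ] Matrix β β ℂ) (x : Fin S.m) : ℝ :=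
  (S.E.effect x * S.output fun _ => Φ).trace.re

lemma isState_output {Φ : Fin S.l → (Matrix α α ℂ →ₗ[ℂ] Matrix β β ℂ)}
    (hΦ : ∀ s, IsChannel (Φ s)) : IsState (S.output Φ) :=
  isState_ampliate_tensorChannel hΦ S.isState

omit [DecidableEq α] in
lemma sum_trace_effect {τ : Matrix ((Fin S.l → β) × Fin S.r) ((Fin S.l → β) × Fin S.r) ℂ}
    (hτ : IsState τ) : ∑ x, (S.E.effect x * τ).trace.re = 1 := by
  rw [← Complex.re_sum, ← Matrix.trace_sum, ← Finset.sum_mul, S.E.sum_eq_one, one_mul, hτ.2,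
    Complex.one_re]

lemma prob_nonneg {Φ : Matrix α α ℂ →ₗ[ℂ] Matrix β β ℂ} (hΦ : IsChannel Φ) (x : Fin S.m) :
    0 ≤ S.prob Φ x :=
  trace_mul_nonneg (S.E.posSemidef x) (S.isState_output fun _ => hΦ).1

lemma sum_prob {Φ : Matrix α α ℂ →ₗ[ℂ] Matrix β β ℂ} (hΦ : IsChannel Φ) :
    ∑ x, S.prob Φ x = 1 :=
  S.sum_trace_effect (S.isState_output fun _ => hΦ)

lemma isProbabilityMeasure_bornLaw {Φ : Fin S.l → (Matrix α α ℂ →ₗ[ℂ] Matrix β β ℂ)}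
    (hΦ : ∀ s, IsChannel (Φ s)) : IsProbabilityMeasure (bornLaw S.E (S.output Φ)) :=
  isProbabilityMeasure_finLaw
    (fun x => trace_mul_nonneg (S.E.posSemidef x) (S.isState_output hΦ).1)
    (S.sum_trace_effect (S.isState_output hΦ))

omit [DecidableEq α] [DecidableEq β] in
lemma isChannel_channelAt (hN : IsChannel N) (hM : IsChannel M) (ν : ℕ∞) (t : ℕ) :
    IsChannel (channelAt N M ν t) := by
  unfold channelAt
  split_ifs
  exacts [hN, hM]

variable (N M) in
lemma lt_stopFrom_iff {h : ℝ} {j : ℕ} {ω : ℕ → Fin S.m} {k : ℕ} :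
    (k : ℕ∞) < S.stopFrom N M h j ω ↔
      ∀ n ≤ k, j < n → ¬ (h : EReal) ≤ ∑ i ∈ Finset.Ico j n, S.logLikelihood N M (ω i) := by
  constructor
  · intro hk n hn hj hle
    have h1 : S.stopFrom N M h j ω ≤ (n : ℕ∞) := iInf₂_le n ⟨hj, hle⟩
    exact absurd (hk.trans_le h1) (not_lt.2 (Nat.cast_le.2 hn))
  · intro hk
    have h1 : ((k + 1 : ℕ) : ℕ∞) ≤ S.stopFrom N M h j ω := by
      refine le_iInf₂ fun n hn => Nat.cast_le.2 ?_
      by_contra hlt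
      exact hk n (by omega) hn.1 hn.2
    exact (Nat.cast_lt.2 k.lt_succ_self).trans_le h1

variable (N M) in
lemma dependsOn_lt_stopFrom (h : ℝ) (j k : ℕ) :
    DependsOn (fun ω : ℕ → Fin S.m => (k : ℕ∞) < S.stopFrom N M h j ω) (Set.Iio k) := by
  intro ω ω' hω
  simp only [S.lt_stopFrom_iff N M]
  refine propext (forall_congr' fun n => forall_congr' fun hn => forall_congr' fun _ => ?_)
  rw [Finset.sum_congr rfl fun i hi => by
    rw [hω i (Set.mem_Iio.2 ((Finset.mem_Ico.1 hi).2.trans_le hn))]]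

variable (N M) in
lemma lt_iInf_stopFrom_iff {h : ℝ} {ω : ℕ → Fin S.m} {k : ℕ} :
    (k : ℕ∞) < ⨅ j, S.stopFrom N M h j ω ↔ ∀ j, (k : ℕ∞) < S.stopFrom N M h j ω := by
  constructor
  · exact fun hk j => hk.trans_le (iInf_le _ j)
  · intro hk
    have h1 : ((k + 1 : ℕ) : ℕ∞) ≤ ⨅ j, S.stopFrom N M h j ω := by
      refine le_iInf fun j => ?_
      push_cast
      exact Order.add_one_le_of_lt (hk j)
    exact (Nat.cast_lt.2 k.lt_succ_self).trans_le h1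

variable (N M) in
lemma dependsOn_lt_iInf_stopFrom (h : ℝ) (k : ℕ) :
    DependsOn (fun ω : ℕ → Fin S.m => (k : ℕ∞) < ⨅ j, S.stopFrom N M h j ω) (Set.Iio k) := by
  intro ω ω' hω
  simp only [S.lt_iInf_stopFrom_iff N M]
  exact propext (forall_congr' fun j => iff_of_eq (S.dependsOn_lt_stopFrom N M h j k hω))

/-! ### Mean false alarm time -/

variable (N M) in
-- This passes from additive CUSUM to likelihood products, infinite values included: `⊥ + ⊤ = ⊥` in
-- the extended reals matches `0 * ∞ = 0`.
lemma sum_logLikelihood (s : Finset ℕ) (ω : ℕ → Fin S.m) :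
    ∑ i ∈ s, S.logLikelihood N M (ω i) = ENNReal.log (∏ i ∈ s,
      bornProb S.E (S.output fun _ => M) (ω i) / bornProb S.E (S.output fun _ => N) (ω i)) := by
  classical
  induction s using Finset.induction_on with
  | empty => simp
  | insert a s ha ih =>
    rw [Finset.sum_insert ha, Finset.prod_insert ha, ENNReal.log_mul_add, ih]
    rfl

omit [Fintype α] [DecidableEq α] [Fintype β] [DecidableEq β] in
lemma channelAt_top (t : ℕ) : channelAt N M ⊤ t = N :=
  if_pos (ENat.natCast_lt_top t)

omit [Fintype α] [DecidableEq α] [Fintype β] [DecidableEq β] in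
lemma channelAt_of_le {ν t : ℕ} (h : ν ≤ t) : channelAt N M ν t = M :=
  if_neg (not_lt.2 (Nat.cast_le.2 h))

lemma bornLaw_singleton (x : Fin S.m) :
    bornLaw S.E (S.output fun _ => M) {x} = ENNReal.ofReal (S.prob M x) :=
  finLaw_singleton _ x

variable (N M) in
-- Under `p` the mean of `q / p` is the mass that `q` gives to the outcomes with `p > 0`. It may be
-- less than `1`.
lemma lintegral_likelihoodRatio_le (hM : IsChannel M) :
    ∫⁻ x, bornProb S.E (S.output fun _ => M) x / bornProb S.E (S.output fun _ => N) x
      ∂(bornLaw S.E (S.output fun _ => N)) ≤ 1 := by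
  rw [lintegral_fintype]
  calc _ ≤ ∑ x, ENNReal.ofReal (S.prob M x) := by
        refine Finset.sum_le_sum fun x _ => ?_
        rw [bornLaw_singleton, mul_comm]
        exact ENNReal.mul_div_le
    _ = 1 := by
        rw [← ENNReal.ofReal_sum_of_nonneg fun x _ => S.prob_nonneg hM x, S.sum_prob hM,
          ENNReal.ofReal_one]

/-- The mean false alarm time is at least the exponential of the threshold. -/
lemma le_meanFalseAlarmTime (hN : IsChannel N) (hM : IsChannel M) {T : ℝ} (hT : 0 < T) :
    ENNReal.ofReal T ≤ S.meanFalseAlarmTime N M (Real.log T) := by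
  obtain ⟨μ, hμ⟩ : ∃ μ : ℕ → Measure (Fin S.m),
      μ = fun _ => bornLaw S.E (S.output fun _ => N) := ⟨_, rfl⟩
  have hlaw : S.law N M ⊤ = Measure.infinitePi μ := by
    simp only [law, channelAt_top, hμ]
  have hp : ∀ k, IsProbabilityMeasure (μ k) := fun k => by
    rw [hμ]
    exact S.isProbabilityMeasure_bornLaw fun _ => hN
  obtain ⟨A, hA⟩ : ∃ A : ℕ → Set (ℕ → Fin S.m), ∀ k ω,
      ω ∈ A k ↔ (k : ℕ∞) < ⨅ j, S.stopFrom N M (Real.log T) j ω :=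
    ⟨fun k => {ω | (k : ℕ∞) < ⨅ j, S.stopFrom N M (Real.log T) j ω}, fun _ _ => Iff.rfl⟩
  have hAd : ∀ n, DependsOn (fun ω => ω ∈ A n) (Set.Iio n) := by
    intro n
    simp only [hA]
    exact S.dependsOn_lt_iInf_stopFrom N M _ n
  have h1 := le_tsum_of_shiryaevRoberts μ
    (fun k => by rw [hμ]; exact S.lintegral_likelihoodRatio_le N M hM)
    (ENNReal.ofReal_ne_top (r := T)) hAd
    (by
      refine Set.eq_univ_of_forall fun ω => (hA _ _).2 ((S.lt_iInf_stopFrom_iff N M).2 fun j => ?_)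
      exact (S.lt_stopFrom_iff N M).2 fun n hn hj => by omega)
    (fun a b hab ω hω => (hA _ _).2 ((Nat.cast_le.2 hab).trans_lt ((hA _ _).1 hω)))
    (by
      -- If the alarm is raised exactly at block count `n + 1`, some likelihood product ending there
      -- reaches `T`, and so does the Shiryaev–Roberts statistic.
      intro n ω hω hω'
      rw [hA, S.lt_iInf_stopFrom_iff N M] at hω hω'
      simp only [S.lt_stopFrom_iff N M] at hω hω'
      push Not at hω'
      obtain ⟨j, k, hk, hj, hle⟩ := hω'
      have hkn : k = n + 1 := by
        by_contra hne
        exact hω j k (by omega) hj hle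
      subst hkn
      rw [sum_logLikelihood, ← ENNReal.log_ofReal_of_pos hT, ENNReal.log_le_log_iff] at hle
      exact hle.trans (prod_le_shiryaevRoberts _ hj ω))
  refine h1.trans ?_
  unfold meanFalseAlarmTime
  rw [hlaw]
  have hAm : ∀ n, MeasurableSet (A n) := fun n =>
    measurableSet_setOfPred.2 (measurable_of_dependsOn (hAd n))
  calc ∑' n, Measure.infinitePi μ (A n)
      = ∑' n, ∫⁻ ω, (A n).indicator 1 ω ∂(Measure.infinitePi μ) := by
        simp only [lintegral_indicator_one (hAm _)]
    _ = ∫⁻ ω, ∑' n, (A n).indicator 1 ω ∂(Measure.infinitePi μ) :=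
        (lintegral_tsum fun n => (measurable_one.indicator (hAm n)).aemeasurable).symm
    _ ≤ _ := by
        refine lintegral_mono fun ω => ?_
        have h2 : ∑' n, (A n).indicator (1 : (ℕ → Fin S.m) → ℝ≥0∞) ω =
            ((⨅ j, S.stopFrom N M (Real.log T) j ω : ℕ∞) : ℝ≥0∞) := by
          rw [toENNReal_eq_tsum]
          refine tsum_congr fun k => ?_
          by_cases hk : ω ∈ A k
          · rw [Set.indicator_of_mem hk, if_pos ((hA k ω).1 hk), Pi.one_apply]
          · rw [Set.indicator_of_notMem hk, if_neg fun h => hk ((hA k ω).2 h)]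
        rw [h2]
        -- The alarm time is `l ≥ 1` times the number of blocks, and the factor `l` is discarded.
        refine ENat.toENNReal_le.2 (le_mul_of_one_le_left zero_le ?_)
        exact_mod_cast S.l_pos

/-! ### Worst-case mean delay -/

variable (N M) in
-- QUSUM stops no later than the single test started at block `j`. The uses between `ν` and the
-- start of that block number at most `l`, and the sum counts the further blocks of that test.
lemma coe_alarmTime_sub_le (h : ℝ) {ν j : ℕ} (hj : j * S.l ≤ ν + S.l) (ω : ℕ → Fin S.m) :
    (S.alarmTime N M h ω : ℝ≥0∞) - (ν : ℝ≥0∞) ≤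
      S.l + S.l * ∑' k : ℕ, if ((j + k : ℕ) : ℕ∞) < S.stopFrom N M h j ω then 1 else 0 := by
  have h1 : (S.alarmTime N M h ω : ℝ≥0∞) ≤ S.l * (S.stopFrom N M h j ω : ℝ≥0∞) := by
    have h2 : S.alarmTime N M h ω ≤ S.l * S.stopFrom N M h j ω := by
      have h0 := iInf_le (fun j => S.stopFrom N M h j ω) j
      unfold alarmTime
      generalize (⨅ j, S.stopFrom N M h j ω) = a at h0 ⊢
      exact mul_le_mul_right h0 _
    have h3 := ENat.toENNReal_le.2 h2
    rwa [ENat.toENNReal_mul, ENat.toENNReal_coe] at h3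
  have h4 := toENNReal_le_add_tsum (S.stopFrom N M h j ω) j
  generalize (∑' k : ℕ, if ((j + k : ℕ) : ℕ∞) < S.stopFrom N M h j ω then (1 : ℝ≥0∞) else 0) = s
    at h4 ⊢
  have h5 : (S.l : ℝ≥0∞) * j ≤ ν + S.l := by
    rw [mul_comm]
    exact_mod_cast hj
  refine tsub_le_iff_right.2 ?_
  calc (S.alarmTime N M h ω : ℝ≥0∞) ≤ S.l * (j + s) := h1.trans (mul_le_mul_right h4 _)
    _ = S.l * j + S.l * s := mul_add _ _ _
    _ ≤ ν + S.l + S.l * s := add_le_add h5 le_rfl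
    _ = S.l + S.l * s + ν := by ring

variable (N M) in
-- Alarms are raised only at ends of blocks, so whether one has been raised by time `ν` is decided
-- by the `⌊ν / l⌋` completed blocks.
lemma lt_alarmTime_iff {h : ℝ} {ν : ℕ} {ω : ℕ → Fin S.m} :
    (ν : ℕ∞) < S.alarmTime N M h ω ↔ ((ν / S.l : ℕ) : ℕ∞) < ⨅ j, S.stopFrom N M h j ω := by
  unfold alarmTime
  induction ⨅ j, S.stopFrom N M h j ω using ENat.recTopCoe with
  | top =>
    rw [ENat.mul_top (Nat.cast_ne_zero.2 S.l_pos.ne')]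
    exact iff_of_true (ENat.natCast_lt_top _) (ENat.natCast_lt_top _)
  | coe n =>
    rw [← Nat.cast_mul, Nat.cast_lt, Nat.cast_lt, Nat.div_lt_iff_lt_mul S.l_pos, mul_comm]

variable (N M) in
lemma dependsOn_lt_alarmTime_inter_past (h : ℝ) (ν : ℕ) (x : ℕ → Fin S.m) :
    DependsOn (fun ω => ω ∈ {ω | (ν : ℕ∞) < S.alarmTime N M h ω} ∩ S.past ν x)
      (Set.Iio (ν / S.l)) := by
  intro ω ω' hω
  have h2 : (ω ∈ S.past ν x) ↔ (ω' ∈ S.past ν x) := by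
    refine forall_congr' fun k => forall_congr' fun hk => ?_
    rw [hω k (Set.mem_Iio.2 hk)]
  refine propext (and_congr ?_ h2)
  simp only [Set.mem_ofPred_eq, S.lt_alarmTime_iff N M]
  exact iff_of_eq (S.dependsOn_lt_iInf_stopFrom N M h _ hω)

lemma logLikelihood_eq_coe (hN : IsChannel N) (hM : IsChannel M) {y : Fin S.m}
    (hac : S.prob N y = 0 → S.prob M y = 0) (hy : S.prob M y ≠ 0) :
    S.logLikelihood N M y = (Real.log (S.prob M y / S.prob N y) : EReal) := by
  have hq : 0 < S.prob M y := (S.prob_nonneg hM y).lt_of_ne' hy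
  have hpp : 0 < S.prob N y := (S.prob_nonneg hN y).lt_of_ne' fun h => hy (hac h)
  have h1 : bornProb S.E (S.output fun _ => M) y / bornProb S.E (S.output fun _ => N) y =
      ENNReal.ofReal (S.prob M y / S.prob N y) := (ENNReal.ofReal_div_of_pos hpp).symm
  rw [logLikelihood, h1, ENNReal.log_ofReal_of_pos (div_pos hq hpp)]

/-- As long as the test started at block `j` has not stopped, the sum of the log-likelihood ratios
is at most the threshold plus the last ratio. -/
lemma sum_indicator_mul_le {h C : ℝ} (hh : 0 ≤ h) (hC0 : 0 ≤ C) {z : Fin S.m → ℝ}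
    (hC : ∀ y, z y ≤ C) {j : ℕ} {G : ℕ → Set (ℕ → Fin S.m)} {ω : ℕ → Fin S.m}
    (hz : ∀ i, j ≤ i → S.logLikelihood N M (ω i) = (z (ω i) : EReal))
    (hG : ∀ k, ω ∈ G k ↔ ((j + k : ℕ) : ℕ∞) < S.stopFrom N M h j ω) (n : ℕ) :
    ∑ k ∈ Finset.range n, (G k).indicator (fun _ => (1 : ℝ)) ω * z (ω (j + k)) ≤ h + C := by
  induction n with
  | zero => simpa using add_nonneg hh hC0
  | succ n ih =>
    rw [Finset.sum_range_succ]
    by_cases hn : ω ∈ G n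
    · have h2 : ∀ k ∈ Finset.range n,
          (G k).indicator (fun _ => (1 : ℝ)) ω * z (ω (j + k)) = z (ω (j + k)) := by
        intro k hk
        have hk' := Finset.mem_range.1 hk
        have h3 : ((j + k : ℕ) : ℕ∞) ≤ ((j + n : ℕ) : ℕ∞) := Nat.cast_le.2 (by omega)
        rw [Set.indicator_of_mem ((hG k).2 (h3.trans_lt ((hG n).1 hn))), one_mul]
      rw [Set.indicator_of_mem hn, one_mul, Finset.sum_congr rfl h2]
      refine add_le_add ?_ (hC _)
      rcases n.eq_zero_or_pos with h0 | h0
      · simpa [h0] using hh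
      · have h3 := (S.lt_stopFrom_iff N M).1 ((hG n).1 hn) (j + n) le_rfl (by omega)
        rw [Finset.sum_congr rfl fun i hi => hz i (Finset.mem_Ico.1 hi).1,
          Finset.sum_Ico_eq_sum_range, Nat.add_sub_cancel_left] at h3
        have h4 : ∑ k ∈ Finset.range n, (z (ω (j + k)) : EReal) =
            ((∑ k ∈ Finset.range n, z (ω (j + k)) : ℝ) : EReal) := by
          induction Finset.range n using Finset.induction_on with
          | empty => simp
          | insert a s ha ih => rw [Finset.sum_insert ha, Finset.sum_insert ha, ih,
              EReal.coe_add]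
        rw [h4, EReal.coe_le_coe_iff] at h3
        exact (not_le.1 h3).le
    · rw [Set.indicator_of_notMem hn, zero_mul, add_zero]
      exact ih

lemma _root_.MeasureTheory.lintegral_cond_le {Ω : Type*} [MeasurableSpace Ω] {P : Measure Ω}
    [IsFiniteMeasure P] {B : Set Ω} {f : Ω → ℝ≥0∞} {c : ℝ≥0∞}
    (h : ∫⁻ ω in B, f ω ∂P ≤ c * P B) : ∫⁻ ω, f ω ∂(ProbabilityTheory.cond P B) ≤ c := by
  rw [ProbabilityTheory.cond, lintegral_smul_measure, smul_eq_mul]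
  -- Conditioning on a null event gives the zero measure, by `∞ * 0 = 0`.
  rcases eq_or_ne (P B) 0 with h0 | h0
  · rw [h0, mul_zero] at h
    rw [le_antisymm h zero_le, mul_zero]
    exact zero_le
  · rw [mul_comm, ← div_eq_mul_inv]
    exact ENNReal.div_le_of_le_mul h

lemma setLIntegral_add_mul_tsum_le {Ω : Type*} [MeasurableSpace Ω] (P : Measure Ω)
    {B : Set Ω} {G : ℕ → Set Ω} (hG : ∀ k, MeasurableSet (G k)) (a b : ℝ≥0∞) :
    ∫⁻ ω in B, (a + b * ∑' k : ℕ, (G k).indicator 1 ω) ∂P ≤ a * P B + b * ∑' k, P (G k) := by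
  have hm : ∀ k, Measurable ((G k).indicator (1 : Ω → ℝ≥0∞)) := fun k =>
    measurable_one.indicator (hG k)
  rw [lintegral_add_left measurable_const, lintegral_const_mul _ (Measurable.tsum hm),
    lintegral_tsum fun k => (hm k).aemeasurable, setLIntegral_const]
  refine add_le_add le_rfl (mul_le_mul_right (ENNReal.tsum_le_tsum fun k => ?_) _)
  rw [lintegral_indicator_one (hG k)]
  exact Measure.restrict_apply_le _ _

/-- The worst mean delay in terms of the relative entropy of the outcomes of one block. -/
lemma worstMeanDelay_le (hN : IsChannel N) (hM : IsChannel M)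
    (hac : ∀ x, S.prob N x = 0 → S.prob M x = 0) {D C h : ℝ}
    (hD : D = ∑ x, S.prob M x * Real.log (S.prob M x / S.prob N x)) (hD0 : 0 < D) (hC0 : 0 ≤ C)
    (hC : ∀ x, Real.log (S.prob M x / S.prob N x) ≤ C) (hh : 0 ≤ h) :
    S.worstMeanDelay N M h ≤ S.l + S.l * ENNReal.ofReal ((h + C) / D) := by
  refine iSup_le fun ν => iSup_le fun x => iSup_le fun _ => ?_
  obtain ⟨μ, hμ⟩ : ∃ μ : ℕ → Measure (Fin S.m),
      μ = fun k => bornLaw S.E (S.output fun s => channelAt N M ν (k * S.l + s)) := ⟨_, rfl⟩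
  have hp : ∀ k, IsProbabilityMeasure (μ k) := fun k => by
    rw [hμ]
    exact S.isProbabilityMeasure_bornLaw fun _ => isChannel_channelAt hN hM _ _
  have hlaw : S.law N M ν = Measure.infinitePi μ := by rw [hμ]; rfl
  -- Block `ν / l` may straddle the change point and is skipped. All blocks from `j` on use only
  -- `M`. If `l` divides `ν`, this skips one block unnecessarily, still at a cost of at most `l`
  -- uses.
  obtain ⟨j, hj⟩ : ∃ j, j = ν / S.l + 1 := ⟨_, rfl⟩
  have hjν : ν < j * S.l := by
    rw [hj, mul_comm]
    exact Nat.lt_mul_div_succ ν S.l_pos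
  have hjν' : j * S.l ≤ ν + S.l := by
    rw [hj, Nat.succ_mul]
    exact Nat.add_le_add_right (Nat.div_mul_le_self ν S.l) _
  have hμM : ∀ k, j ≤ k → μ k = bornLaw S.E (S.output fun _ => M) := by
    intro k hk
    have h1 : ∀ s : Fin S.l, channelAt N M ν (k * S.l + s) = M := fun s =>
      channelAt_of_le (by have := Nat.mul_le_mul_right S.l hk; omega)
    simp only [hμ, h1]
  have hBd := S.dependsOn_lt_alarmTime_inter_past N M h ν x
  generalize {ω | (ν : ℕ∞) < S.alarmTime N M h ω} ∩ S.past ν x = B at hBd ⊢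
  have hBm : MeasurableSet B := measurableSet_setOfPred.2 (measurable_of_dependsOn hBd)
  -- `B` is determined by blocks before `j`, so intersecting with it keeps `G k` in the past of
  -- block `j + k`. This makes the bound uniform in the record.
  obtain ⟨G, hG⟩ : ∃ G : ℕ → Set (ℕ → Fin S.m), ∀ k ω,
      ω ∈ G k ↔ ω ∈ B ∧ ((j + k : ℕ) : ℕ∞) < S.stopFrom N M h j ω :=
    ⟨fun k => B ∩ {ω | ((j + k : ℕ) : ℕ∞) < S.stopFrom N M h j ω}, fun _ _ => Iff.rfl⟩
  have hGd : ∀ k, DependsOn (fun ω => ω ∈ G k) (Set.Iio (j + k)) := by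
    intro k ω ω' hω
    simp only [hG]
    refine propext (and_congr (iff_of_eq (hBd fun i hi => hω i ?_))
      (iff_of_eq (S.dependsOn_lt_stopFrom N M h j (j + k) hω)))
    have := Set.mem_Iio.1 hi
    exact Set.mem_Iio.2 (by omega)
  have hGm : ∀ k, MeasurableSet (G k) := fun k =>
    measurableSet_setOfPred.2 (measurable_of_dependsOn (hGd k))
  have hint : ∀ k, j ≤ k → ∫ x, Real.log (S.prob M x / S.prob N x) ∂(μ k) = D := by
    intro k hk
    rw [integral_fintype .of_finite, hD]
    refine Finset.sum_congr rfl fun y _ => ?_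
    rw [hμM k hk, Measure.real, bornLaw_singleton, ENNReal.toReal_ofReal (S.prob_nonneg hM y),
      smul_eq_mul]
  -- Under `M` an outcome with `q = 0` almost surely never occurs, so the log-likelihood ratios from
  -- block `j` on are real.
  have hae : ∀ᵐ ω ∂(Measure.infinitePi μ), ∀ i, j ≤ i → S.prob M (ω i) ≠ 0 := by
    refine ae_all_iff.2 fun i => ?_
    by_cases hi : j ≤ i
    · have h1 : ∀ᵐ y ∂(μ i), S.prob M y ≠ 0 := by
        refine ae_iff_of_countable.2 fun y hy h0 => hy ?_
        rw [hμM i hi, bornLaw_singleton, h0, ENNReal.ofReal_zero]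
      filter_upwards [(measurePreserving_eval_infinitePi μ i).quasiMeasurePreserving.ae h1]
        with ω hω _ using hω
    · exact Eventually.of_forall fun ω h => absurd h hi
  have hdrift := tsum_measure_le_of_drift μ hD0 hint hBm hGd (H := h + C) (by positivity)
    (by
      intro n
      filter_upwards [hae] with ω hω
      by_cases hωB : ω ∈ B
      · rw [Set.indicator_of_mem hωB]
        exact S.sum_indicator_mul_le (N := N) (M := M) hh hC0 hC
          (fun i hi => S.logLikelihood_eq_coe hN hM (hac _) (hω i hi))
          (fun k => (hG k ω).trans (and_iff_right hωB)) n
      · rw [Set.indicator_of_notMem hωB]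
        refine (Finset.sum_eq_zero fun k _ => ?_).le
        rw [Set.indicator_of_notMem fun h => hωB ((hG k ω).1 h).1, zero_mul])
  rw [hlaw]
  refine lintegral_cond_le ?_
  calc ∫⁻ ω in B, ((S.alarmTime N M h ω : ℝ≥0∞) - (ν : ℝ≥0∞)) ∂(Measure.infinitePi μ)
      ≤ ∫⁻ ω in B, (S.l + S.l * ∑' k : ℕ, (G k).indicator 1 ω) ∂(Measure.infinitePi μ) := by
        refine setLIntegral_mono' hBm fun ω hω =>
          (S.coe_alarmTime_sub_le N M h hjν' ω).trans_eq ?_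
        congr 2
        refine tsum_congr fun k => ?_
        by_cases hk : ω ∈ G k
        · rw [Set.indicator_of_mem hk, if_pos ((hG k ω).1 hk).2, Pi.one_apply]
        · rw [Set.indicator_of_notMem hk, if_neg fun h => hk ((hG k ω).2 ⟨hω, h⟩)]
    _ ≤ S.l * Measure.infinitePi μ B + S.l * ∑' k, Measure.infinitePi μ (G k) :=
        setLIntegral_add_mul_tsum_le _ hGm _ _
    _ ≤ S.l * Measure.infinitePi μ B +
          S.l * (ENNReal.ofReal ((h + C) / D) * Measure.infinitePi μ B) :=
        add_le_add le_rfl (mul_le_mul_right hdrift _)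
    _ = _ := by ring

end BlockScheme

end ChangePoint

namespace ChangePoint

/-! ### Optimality -/

section

variable {α β : Type*} [Fintype α] [DecidableEq α] [Fintype β] [DecidableEq β]
  {N M : Matrix α α ℂ →ₗ[ℂ] Matrix β β ℂ}

/-- A measurement whose relative entropy per channel use exceeds `c`. -/
lemma exists_blockScheme_lt [Nonempty α] (hN : IsChannel N) (hM : IsChannel M)
    (hfin : regularizedRelEntropy M N ≠ ∞) {c : ℝ} (hc0 : 0 ≤ c)
    (hc : ENNReal.ofReal c < regularizedRelEntropy M N) :
    ∃ S : BlockScheme α β, (∀ x, S.prob N x = 0 → S.prob M x = 0) ∧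
      S.l * c < ∑ x, S.prob M x * Real.log (S.prob M x / S.prob N x) := by
  have hreg := regularizedRelEntropy_eq hM hN
  rw [hreg] at hc
  obtain ⟨n, hc⟩ := lt_iSup_iff.1 hc
  obtain ⟨hn, hc⟩ := lt_iSup_iff.1 hc
  have hn0 : (n : ℝ≥0∞) ≠ 0 := Nat.cast_ne_zero.2 (by omega)
  rw [ENNReal.lt_div_iff_mul_lt (Or.inl hn0) (Or.inl (ENNReal.natCast_ne_top n)),
    measuredChannelRelEntropy_eq_sSup hM hN, lt_sSup_iff] at hc
  obtain ⟨v, hv, hc⟩ := hc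
  -- Finiteness of the regularized rate bounds `v`, so the outcome laws are absolutely continuous,
  -- as the delay bound requires.
  have hv' : v ≠ ∞ := by
    refine ne_top_of_le_ne_top (ENNReal.mul_ne_top (ENNReal.natCast_ne_top n) hfin)
      ((le_sSup hv).trans ?_)
    rw [← measuredChannelRelEntropy_eq_sSup hM hN, hreg]
    exact mul_iSup_div_ge (g := fun n => measuredChannelRelEntropy (tensorPower M n)
      (tensorPower N n)) hn
  obtain ⟨r, ω, m, E, hω, rfl⟩ := hv
  unfold klFin at hc hv'
  split_ifs at hc hv' with hac
  · refine ⟨⟨n, hn, r, m, ω, hω, E⟩, hac, ?_⟩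
    rw [← ENNReal.ofReal_natCast, ← ENNReal.ofReal_mul hc0, mul_comm] at hc
    exact (ENNReal.ofReal_lt_ofReal_iff_of_nonneg (by positivity)).1 hc
  · exact absurd rfl hv'

/-- Half of `ε` pays for a block scheme whose rate is slightly below the optimum, the other half for
the skipped block and the overshoot, which are constants once the scheme is fixed. -/
lemma exists_blockScheme [Nonempty α] (hN : IsChannel N) (hM : IsChannel M)
    (hfin : regularizedRelEntropy M N ≠ ∞) {ε : ℝ} (hε : 0 < ε) :
    ∃ S : BlockScheme α β, ∀ᶠ T : ℝ in atTop,
      ENNReal.ofReal T ≤ S.meanFalseAlarmTime N M (Real.log T) ∧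
      S.worstMeanDelay N M (Real.log T) ≤
        ENNReal.ofReal (Real.log T * (1 + ε)) / regularizedRelEntropy M N := by
  rcases eq_or_ne (regularizedRelEntropy M N) 0 with h0 | h0
  -- At rate zero the delay bound is a positive number divided by zero, hence `∞`, and any scheme
  -- works.
  · obtain ⟨ω, hω⟩ := exists_isState ((Fin 1 → α) × Fin 1)
    refine ⟨⟨1, one_pos, 1, 1, ω, hω, trivialPOVM _⟩, ?_⟩
    filter_upwards [eventually_gt_atTop 1] with T hT
    refine ⟨BlockScheme.le_meanFalseAlarmTime _ hN hM (by linarith), ?_⟩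
    have h1 : 0 < Real.log T * (1 + ε) := mul_pos (Real.log_pos hT) (by linarith)
    rw [h0, ENNReal.div_zero (ENNReal.ofReal_pos.2 h1).ne']
    exact le_top
  obtain ⟨G, hG⟩ : ∃ G, G = (regularizedRelEntropy M N).toReal := ⟨_, rfl⟩
  have hG0 : 0 < G := hG ▸ ENNReal.toReal_pos h0 hfin
  have hGe : regularizedRelEntropy M N = ENNReal.ofReal G := by
    rw [hG, ENNReal.ofReal_toReal hfin]
  obtain ⟨S, hac, hS⟩ := exists_blockScheme_lt hN hM hfin (c := G / (1 + ε / 2)) (by positivity)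
    (by
      rw [hGe]
      exact (ENNReal.ofReal_lt_ofReal_iff hG0).2 (div_lt_self hG0 (by linarith)))
  obtain ⟨D, hD⟩ : ∃ D, D = ∑ x, S.prob M x * Real.log (S.prob M x / S.prob N x) := ⟨_, rfl⟩
  rw [← hD] at hS
  have hl0 : (0 : ℝ) < S.l := Nat.cast_pos.2 S.l_pos
  have hD0 : 0 < D := lt_trans (by positivity) hS
  have hlD : S.l / D ≤ (1 + ε / 2) / G := by
    rw [mul_div_assoc', div_lt_iff₀ (by positivity)] at hS
    rw [div_le_div_iff₀ hD0 hG0]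
    linarith
  obtain ⟨C, hC⟩ : ∃ C, C = ∑ x, |Real.log (S.prob M x / S.prob N x)| := ⟨_, rfl⟩
  have hC0 : 0 ≤ C := hC ▸ Finset.sum_nonneg fun _ _ => abs_nonneg _
  have hCx : ∀ x, Real.log (S.prob M x / S.prob N x) ≤ C := fun x =>
    (le_abs_self _).trans (hC ▸ Finset.single_le_sum
      (f := fun x => |Real.log (S.prob M x / S.prob N x)|) (fun _ _ => abs_nonneg _)
      (Finset.mem_univ x))
  refine ⟨S, ?_⟩
  -- The condition on `log T` says `l G + C (1 + ε / 2) ≤ (ε / 2) log T`, which absorbs all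
  -- constants into the second half of `ε`.
  filter_upwards [eventually_gt_atTop 1, Real.tendsto_log_atTop.eventually_ge_atTop
    ((S.l * G + C * (1 + ε / 2)) / (ε / 2))] with T hT hlog
  refine ⟨S.le_meanFalseAlarmTime hN hM (by linarith), ?_⟩
  have hh : 0 ≤ Real.log T := Real.log_nonneg hT.le
  refine (S.worstMeanDelay_le hN hM hac hD hD0 hC0 hCx hh).trans ?_
  rw [hGe, ← ENNReal.ofReal_div_of_pos hG0, ← ENNReal.ofReal_natCast,
    ← ENNReal.ofReal_mul hl0.le, ← ENNReal.ofReal_add hl0.le (by positivity)]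
  refine ENNReal.ofReal_le_ofReal ?_
  rw [div_le_iff₀ (by positivity)] at hlog
  calc S.l + S.l * ((Real.log T + C) / D) = S.l + (Real.log T + C) * (S.l / D) := by ring
    _ ≤ S.l + (Real.log T + C) * ((1 + ε / 2) / G) := by gcongr
    _ = (S.l * G + (Real.log T + C) * (1 + ε / 2)) / G := by field_simp
    _ ≤ Real.log T * (1 + ε) / G := by
      gcongr
      linarith

end

/-- A diagonal argument. -/
lemma exists_tendsto_zero_of_forall_eventually {p : ℝ → ℝ → Prop}
    (hp : ∀ ε, 0 < ε → ∀ᶠ t in atTop, p ε t) :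
    ∃ δ : ℝ → ℝ, Tendsto δ atTop (𝓝 0) ∧ ∀ᶠ t in atTop, p (δ t) t := by
  classical
  have hp' : ∀ n : ℕ, ∀ᶠ t in atTop, p (1 / ((n : ℝ) + 1)) t := fun n => hp _ (by positivity)
  -- `k t` is the largest `n ≤ ⌊t⌋` for which tolerance `1 / (n + 1)` is already achieved at `t`.
  -- The cap guarantees that a largest one exists. Each `n` is eventually admissible, so `k` tends
  -- to infinity, and admissibility of `n = 0` ensures that `k t` itself is admissible.
  let k : ℝ → ℕ := fun t => Nat.findGreatest (fun n => p (1 / ((n : ℝ) + 1)) t) ⌊t⌋₊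
  refine ⟨fun t => 1 / ((k t : ℝ) + 1), ?_, ?_⟩
  · refine tendsto_one_div_add_atTop_nhds_zero_nat.comp (tendsto_atTop.2 fun n => ?_)
    filter_upwards [hp' n, eventually_ge_atTop (n : ℝ)] with t ht hn
    exact Nat.le_findGreatest (Nat.le_floor hn) ht
  · filter_upwards [hp' 0] with t ht
    exact Nat.findGreatest_spec (P := fun n => p (1 / ((n : ℝ) + 1)) t) (Nat.zero_le _) ht

end ChangePoint

theorem mainTheorem6 {α β : Type*} [Fintype α] [DecidableEq α] [Nonempty α]
    [Fintype β] [DecidableEq β]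
    (N M : Matrix α α ℂ →ₗ[ℂ] Matrix β β ℂ)
    (hN : ChangePoint.IsChannel N) (hM : ChangePoint.IsChannel M) :
    Tendsto (fun l : ℕ => ChangePoint.channelRelEntropy (ChangePoint.tensorPower M l)
        (ChangePoint.tensorPower N l) / (l : ℝ≥0∞))
      atTop (𝓝 (ChangePoint.regularizedRelEntropy M N)) ∧
    Tendsto (fun l : ℕ => ChangePoint.measuredChannelRelEntropy (ChangePoint.tensorPower M l)
        (ChangePoint.tensorPower N l) / (l : ℝ≥0∞))
      atTop (𝓝 (ChangePoint.regularizedRelEntropy M N)) ∧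
    (ChangePoint.regularizedRelEntropy M N ≠ ∞ →
      (∀ ε : ℝ, 0 < ε → ∃ S : ChangePoint.BlockScheme α β, ∀ᶠ T : ℝ in atTop,
        ENNReal.ofReal T ≤ S.meanFalseAlarmTime N M (Real.log T) ∧
        S.worstMeanDelay N M (Real.log T) ≤
          ENNReal.ofReal (Real.log T * (1 + ε)) / ChangePoint.regularizedRelEntropy M N) ∧
      (∃ δ : ℝ → ℝ, Tendsto δ atTop (𝓝 0) ∧ ∀ᶠ T : ℝ in atTop,
        ∃ S : ChangePoint.BlockScheme α β,
          ENNReal.ofReal T ≤ S.meanFalseAlarmTime N M (Real.log T) ∧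
          S.worstMeanDelay N M (Real.log T) ≤
            ENNReal.ofReal (Real.log T * (1 + δ T)) /
              ChangePoint.regularizedRelEntropy M N)) := by
  have hreg := ChangePoint.regularizedRelEntropy_eq hM hN
  refine ⟨hreg ▸ ChangePoint.tendsto_channelRelEntropy hM hN,
    hreg ▸ ChangePoint.tendsto_div_of_superadditive
      (ChangePoint.measuredChannelRelEntropy_add_le hM hN), fun hfin => ⟨fun ε hε =>
    ChangePoint.exists_blockScheme hN hM hfin hε,
    ChangePoint.exists_tendsto_zero_of_forall_eventually (p := fun ε T =>
      ∃ S : ChangePoint.BlockScheme α β,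
        ENNReal.ofReal T ≤ S.meanFalseAlarmTime N M (Real.log T) ∧
        S.worstMeanDelay N M (Real.log T) ≤
          ENNReal.ofReal (Real.log T * (1 + ε)) /
            ChangePoint.regularizedRelEntropy M N) fun ε hε => ?_⟩⟩
  obtain ⟨S, hS⟩ := ChangePoint.exists_blockScheme hN hM hfin hε
  filter_upwards [hS] with T hT using ⟨S, hT⟩
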